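/- **Corollary 5.5.** Let $\mathbf T=(T_1,T_2)$ be a commuting pair of contractions on $\ell^2(\mathbb Z_+^2)$, with $T_1$ and $T_2$ each a subnormal operator, given by $$T_1e_{\mathbf k}=\alpha_{\mathbf k}e_{\mathbf k+(1,0)},\qquad T_2e_{\mathbf k}=\beta_{\mathbf k}e_{\mathbf k+(0,1)}\qquad(\mathbf k\in\mathbb Z_+^2),$$ where the positive bounded weights are determined by two sequences $(x_n)_{n\ge0}$, $(y_n)_{n\ge0}$ and a number $a$ as follows: * $\alpha_{(n,0)}=x_n$ for $n\ge0$; $\ \alpha_{(0,1)}=a$; $\ \alpha_{(0,n)}=\dfrac{a}{y_1y_2\cdots y_{n-1}}$ for $n\ge2$; $\ \alpha_{(k_1,k_2)}=1$ for $k_1,k_2\ge1$; * $\beta_{(0,n)}=y_n$ for $n\ge0$; $\ \beta_{(n,0)}=\dfrac{a\,y_0}{x_0x_1\cdots x_{n-1}}$ for $n\ge1$; $\ \beta_{(k_1,k_2)}=1$ for $k_1,k_2\ge1$. (That is, $\mathbf T$ is a symmetrically flat, contractive $2$-variable weighted shift with $T_1,T_2$ subnormal.) Let $\xi$ and $\eta_1$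 be the Berger measures of the unilateral weighted shifts $\mathrm{shift}(x_0,x_1,\dots)$ and $\mathrm{shift}(y_1,y_2,\dots)$; here the Berger measure of $W=\mathrm{shift}(w_0,w_1,\dots)$ is the probability measure $\mu$ supported in $[0,\|W\|^2]$ with $\int t^k\,d\mu(t)=w_0^2\cdots w_{k-1}^2$ for all $k\ge0$. Put $p:=\xi(\{0\})$, $q:=\xi(\{1\})$, $$h:=\sqrt{\frac{x_0^2y_1^2(x_1^2-x_0^2)}{x_0^2(x_1^2-x_0^2)+(a^2-x_0^2)^2}},\qquad s:=\min\left\{\sqrt{\frac{q}{a^2}},\ \sqrt{\frac{p}{\left\|\frac1t\right\|_{L^1(\eta_1)}-a^2}}\right\},$$ where the second term of the minimum is read as $+\infty$ if $\|1/t\|_{L^1(\eta_1)}=a^2$, and $h:=0$ if its denominator is $0$ (which happens only if $x_0=x_1=a$). Then $\mathbf T$ is jointly hyponormal and not subnormal if and only if $$s<y_0\le h.$$ Here $\mathbf T$ is jointly hyponormal if the operator matrix $\big([T_j^*,T_i]\big)_{i,j=1}^2$ is positive on $\ell^2(\mathbb Z_+^2)\oplus\ell^2(\mathbb Z_+^2)$,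 and subnormal if it is the restriction of a commuting pair of normal operators to a common invariant subspace. -/

import Mathlib

open MeasureTheory

universe u v

/-! ## Hyponormal and subnormal tuples of operators -/

section Tuples

variable {ι : Type*} [Fintype ι] {H : Type*} [NormedAddCommGroup H] [InnerProductSpace ℂ H]

/-- The operator on the Hilbert direct sum `⊕_{i : ι} H` given by a matrix of operators on `H`:
`(A x) i = ∑ j, A i j (x j)`. -/
noncomputable def operatorMatrix (A : ι → ι → (H →L[ℂ] H)) :
    PiLp 2 (fun _ : ι => H) →L[ℂ] PiLp 2 (fun _ : ι => H) :=
  ((PiLp.continuousLinearEquiv 2 ℂ (fun _ : ι => H)).symm :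
      (ι → H) →L[ℂ] PiLp 2 (fun _ : ι => H)) ∘L
    ContinuousLinearMap.pi fun i => ∑ j, A i j ∘L PiLp.proj 2 (fun _ : ι => H) j

theorem operatorMatrix_apply (A : ι → ι → (H →L[ℂ] H)) (f : PiLp 2 (fun _ : ι => H)) (i : ι) :
    operatorMatrix A f i = ∑ j, A i j (f j) := by
  simp [operatorMatrix]

/-- A tuple of operators is (jointly) hyponormal if it is commuting and the operator matrix whose
`(i, j)` entry is the commutator `[Tⱼ*, Tᵢ] = Tⱼ* Tᵢ - Tᵢ Tⱼ*` is positive on the direct sum. -/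
def IsJointlyHyponormal [CompleteSpace H] (T : ι → (H →L[ℂ] H)) : Prop :=
  (∀ i j, Commute (T i) (T j)) ∧
    (operatorMatrix fun i j =>
      ContinuousLinearMap.adjoint (T j) ∘L T i -
        T i ∘L ContinuousLinearMap.adjoint (T j)).IsPositive

end Tuples

/-- A tuple of operators on `H` is subnormal if `H` embeds isometrically, as a common invariant
subspace, into a Hilbert space `K` carrying a commuting tuple `N` of normal operators whose
restriction to `H` is `T`. -/
def IsJointlySubnormal {ι : Type v} {H : Type u} [NormedAddCommGroup H] [InnerProductSpace ℂ H]
    (T : ι → (H →L[ℂ] H)) : Prop :=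
  ∃ (K : Type u) (_ : NormedAddCommGroup K) (_ : InnerProductSpace ℂ K) (_ : CompleteSpace K)
    (V : H →ₗᵢ[ℂ] K) (N : ι → (K →L[ℂ] K)),
    (∀ i j, Commute (N i) (N j)) ∧ (∀ i, IsStarNormal (N i)) ∧
      ∀ i f, N i (V f) = V (T i f)

/-- A single operator is subnormal if it is the restriction of a normal operator to an invariant
subspace. -/
def IsSubnormalOperator {H : Type*} [NormedAddCommGroup H] [InnerProductSpace ℂ H]
    (T : H →L[ℂ] H) : Prop :=
  IsJointlySubnormal fun _ : Unit => T

/-! ## Weighted shifts on `ℓ²` -/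

section Shift

variable {κ : Type*}

theorem weightedShift_summable (w : κ → ℝ) (C : ℝ) (hw : ∀ k, |w k| ≤ C)
    (f : lp (fun _ : κ => ℂ) 2) :
    Summable (fun k => ‖(w k : ℂ) * f k‖ ^ (2 : ℝ)) ∧
      ∑' k, ‖(w k : ℂ) * f k‖ ^ (2 : ℝ) ≤ (C * ‖f‖) ^ (2 : ℝ) := by
  have hf := lp.hasSum_norm (p := 2) (by norm_num) f
  simp only [ENNReal.toReal_ofNat] at hf
  have hle : ∀ k, ‖(w k : ℂ) * f k‖ ^ (2 : ℝ) ≤ C ^ (2 : ℝ) * ‖f k‖ ^ (2 : ℝ) := by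
    intro k
    have hC : 0 ≤ C := (abs_nonneg _).trans (hw k)
    rw [← Real.mul_rpow hC (norm_nonneg _)]
    refine Real.rpow_le_rpow (norm_nonneg _) ?_ (by norm_num)
    rw [norm_mul, Complex.norm_real, Real.norm_eq_abs]
    exact mul_le_mul_of_nonneg_right (hw k) (norm_nonneg _)
  have hs : Summable (fun k => ‖(w k : ℂ) * f k‖ ^ (2 : ℝ)) :=
    Summable.of_nonneg_of_le (fun k => by positivity) hle (hf.mul_left _).summable
  refine ⟨hs, (hs.tsum_le_tsum hle (hf.mul_left _).summable).trans ?_⟩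
  rw [(hf.mul_left _).tsum_eq]
  rcases isEmpty_or_nonempty κ with h | ⟨⟨k⟩⟩
  · have : f = 0 := by ext k; exact h.elim k
    simp [this]
  · rw [Real.mul_rpow ((abs_nonneg _).trans (hw k)) (norm_nonneg _)]

theorem weightedShift_extend (φ : κ ↪ κ) (w : κ → ℝ) (f : κ → ℂ) :
    (fun k => ‖Function.extend φ (fun l => (w l : ℂ) * f l) 0 k‖ ^ (2 : ℝ)) =
      Function.extend φ (fun l => ‖(w l : ℂ) * f l‖ ^ (2 : ℝ)) 0 := by
  funext k
  by_cases h : ∃ l, φ l = k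
  · obtain ⟨l, rfl⟩ := h
    rw [φ.injective.extend_apply, φ.injective.extend_apply]
  · rw [Function.extend_apply' _ _ _ h, Function.extend_apply' _ _ _ h]
    simp

/-- The bounded operator on `ℓ²(κ)` with `e_k ↦ w k • e_(φ k)`, for bounded weights `w`; in
coordinates, `(S f) (φ k) = w k * f k`, and `S f` vanishes off the range of `φ`. -/
noncomputable def weightedShift (φ : κ ↪ κ) (w : κ → ℝ) (hw : ∃ C, ∀ k, |w k| ≤ C) :
    lp (fun _ : κ => ℂ) 2 →L[ℂ] lp (fun _ : κ => ℂ) 2 :=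
  LinearMap.mkContinuousOfExistsBound
    { toFun := fun f =>
        ⟨Function.extend φ (fun k => (w k : ℂ) * f k) 0, by
          obtain ⟨C, hC⟩ := hw
          refine memℓp_gen ?_
          simp only [ENNReal.toReal_ofNat]
          rw [weightedShift_extend]
          exact (summable_extend_zero φ.injective).2 (weightedShift_summable w C hC f).1⟩
      map_add' := by
        intro f g
        ext k
        change Function.extend φ (fun l => (w l : ℂ) * (f + g) l) 0 k =
          Function.extend φ (fun l => (w l : ℂ) * f l) 0 k +
            Function.extend φ (fun l => (w l : ℂ) * g l) 0 k
        by_cases h : ∃ l, φ l = k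
        · obtain ⟨l, rfl⟩ := h
          simp only [φ.injective.extend_apply]
          rw [lp.coeFn_add, Pi.add_apply, mul_add]
        · simp [Function.extend_apply' _ _ _ h]
      map_smul' := by
        intro c f
        ext k
        change Function.extend φ (fun l => (w l : ℂ) * (c • f) l) 0 k =
          c * Function.extend φ (fun l => (w l : ℂ) * f l) 0 k
        by_cases h : ∃ l, φ l = k
        · obtain ⟨l, rfl⟩ := h
          simp only [φ.injective.extend_apply]
          rw [lp.coeFn_smul, Pi.smul_apply, smul_eq_mul]
          ring
        · simp [Function.extend_apply' _ _ _ h] }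
    (by
      obtain ⟨C, hC⟩ := hw
      refine ⟨|C|, fun f => ?_⟩
      have h2 := (weightedShift_summable w |C| (fun k => (hC k).trans (le_abs_self C)) f)
      refine lp.norm_le_of_tsum_le (p := 2) (by norm_num) (by positivity) ?_
      simp only [ENNReal.toReal_ofNat]
      change ∑' k, ‖Function.extend φ (fun l => (w l : ℂ) * f l) 0 k‖ ^ (2 : ℝ) ≤ _
      rw [weightedShift_extend, tsum_extend_zero φ.injective]
      exact h2.2)

theorem weightedShift_apply (φ : κ ↪ κ) (w : κ → ℝ) (hw : ∃ C, ∀ k, |w k| ≤ C)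
    (f : lp (fun _ : κ => ℂ) 2) (k : κ) :
    weightedShift φ w hw f (φ k) = (w k : ℂ) * f k :=
  φ.injective.extend_apply (fun l => (w l : ℂ) * f l) 0 k

theorem weightedShift_apply_of_notMem (φ : κ ↪ κ) (w : κ → ℝ) (hw : ∃ C, ∀ k, |w k| ≤ C)
    (f : lp (fun _ : κ => ℂ) 2) (k : κ) (hk : ¬ ∃ l, φ l = k) :
    weightedShift φ w hw f k = 0 :=
  Function.extend_apply' (fun l => (w l : ℂ) * f l) (0 : κ → ℂ) k hk

theorem weightedShift_single [DecidableEq κ] (φ : κ ↪ κ) (w : κ → ℝ) (hw : ∃ C, ∀ k, |w k| ≤ C)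
    (k : κ) :
    weightedShift φ w hw (lp.single 2 k (1 : ℂ)) = (w k : ℂ) • lp.single 2 (φ k) (1 : ℂ) := by
  ext l
  rw [lp.coeFn_smul, Pi.smul_apply, lp.single_apply, smul_eq_mul]
  by_cases h : ∃ m, φ m = l
  · obtain ⟨m, rfl⟩ := h
    rw [weightedShift_apply, lp.single_apply]
    by_cases hm : m = k
    · subst hm; simp
    · have h' : φ m ≠ φ k := fun e => hm (φ.injective e)
      simp [Pi.single_eq_of_ne hm, Pi.single_eq_of_ne h']
  · have h' : l ≠ φ k := fun e => h ⟨k, e.symm⟩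
    rw [weightedShift_apply_of_notMem φ w hw _ l h]
    simp [Pi.single_eq_of_ne h']

end Shift

/-- The weights of a 2-variable weighted shift: two positive bounded families indexed by
`(k₁, k₂) ∈ ℤ₊²`. -/
structure ShiftWeights where
  α : ℕ × ℕ → ℝ
  β : ℕ × ℕ → ℝ
  α_pos : ∀ k, 0 < α k
  β_pos : ∀ k, 0 < β k
  α_bdd : ∃ C, ∀ k, |α k| ≤ C
  β_bdd : ∃ C, ∀ k, |β k| ≤ C

namespace ShiftWeights

/-- `T₁ e_k = α_k e_(k + (1, 0))` on `ℓ²(ℤ₊²)`. -/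
noncomputable def T₁ (W : ShiftWeights) :
    lp (fun _ : ℕ × ℕ => ℂ) 2 →L[ℂ] lp (fun _ : ℕ × ℕ => ℂ) 2 :=
  weightedShift (addRightEmbedding (1, 0)) W.α W.α_bdd

/-- `T₂ e_k = β_k e_(k + (0, 1))` on `ℓ²(ℤ₊²)`. -/
noncomputable def T₂ (W : ShiftWeights) :
    lp (fun _ : ℕ × ℕ => ℂ) 2 →L[ℂ] lp (fun _ : ℕ × ℕ => ℂ) 2 :=
  weightedShift (addRightEmbedding (0, 1)) W.β W.β_bdd

/-- The pair `(T₁, T₂)`. -/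
noncomputable def pair (W : ShiftWeights) :
    Fin 2 → (lp (fun _ : ℕ × ℕ => ℂ) 2 →L[ℂ] lp (fun _ : ℕ × ℕ => ℂ) 2) :=
  ![W.T₁, W.T₂]

/-- `α` is constant on the indices with `k₁, k₂ ≥ 1`. -/
def HorizontallyFlat (W : ShiftWeights) : Prop :=
  ∀ k₁ k₂ : ℕ, 1 ≤ k₁ → 1 ≤ k₂ → W.α (k₁, k₂) = W.α (1, 1)

/-- `β` is constant on the indices with `k₁, k₂ ≥ 1`. -/
def VerticallyFlat (W : ShiftWeights) : Prop :=
  ∀ k₁ k₂ : ℕ, 1 ≤ k₁ → 1 ≤ k₂ → W.β (k₁, k₂) = W.β (1, 1)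

/-- Horizontally and vertically flat with the same constant. -/
def SymmetricallyFlat (W : ShiftWeights) : Prop :=
  W.HorizontallyFlat ∧ W.VerticallyFlat ∧ W.α (1, 1) = W.β (1, 1)

/-- The class of symmetrically flat, contractive, commuting 2-variable weighted shifts (normalized
by `α (1, 1) = β (1, 1) = 1`) for which `T₁` and `T₂` are subnormal operators. -/
structure IsSFC (W : ShiftWeights) : Prop where
  comm : Commute W.T₁ W.T₂
  symmFlat : W.SymmetricallyFlat
  normalized : W.α (1, 1) = 1
  contractive₁ : ‖W.T₁‖ ≤ 1
  contractive₂ : ‖W.T₂‖ ≤ 1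
  subnormal₁ : IsSubnormalOperator W.T₁
  subnormal₂ : IsSubnormalOperator W.T₂

end ShiftWeights

/-! ## One-variable weighted shifts: moments and Berger measures -/

/-- The moments `γ₀ = 1`, `γ_k = w₀² ⋯ w_{k-1}²` of `shift(w₀, w₁, …)`. -/
def shiftMoment (w : ℕ → ℝ) (k : ℕ) : ℝ :=
  ∏ i ∈ Finset.range k, w i ^ 2

/-- `μ` is the Berger measure of `shift(w₀, w₁, …)` (positive bounded weights): a probability
measure supported in `[0, ‖W_w‖²]`, where `‖W_w‖ = sup w`, whose moments are those of the shift. -/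
structure IsBergerMeasure (w : ℕ → ℝ) (μ : Measure ℝ) : Prop where
  isProbabilityMeasure : IsProbabilityMeasure μ
  support : μ (Set.Icc 0 ((⨆ n, w n) ^ 2))ᶜ = 0
  moment : ∀ k : ℕ, ∫ t, t ^ k ∂μ = shiftMoment w k

/-! ## The symmetrically flat weight diagram -/

/-- Horizontal weights of the diagram with `0`-th row `x`, `0`-th column `y` and `α₀₁ = a`:
the `0`-th row is `x₀, x₁, …`; the row at height `m + 1` is `a / √γ_m(y₁, y₂, …), 1, 1, …`. -/
noncomputable def diagramAlpha (x y : ℕ → ℝ) (a : ℝ) : ℕ × ℕ → ℝ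
  | (k₁, 0) => x k₁
  | (0, m + 1) => a / √(shiftMoment (fun n => y (n + 1)) m)
  | (_ + 1, _ + 1) => 1

/-- Vertical weights of the same diagram: the `0`-th column is `y₀, y₁, …`; the column at
abscissa `n + 1` is `a y₀ / √γ_{n+1}(x₀, x₁, …), 1, 1, …`. -/
noncomputable def diagramBeta (x y : ℕ → ℝ) (a : ℝ) : ℕ × ℕ → ℝ
  | (0, k₂) => y k₂
  | (n + 1, 0) => a * y 0 / √(shiftMoment x (n + 1))
  | (_ + 1, _ + 1) => 1

/-- The threshold `h`, a function of `x₀, x₁, y₁, a`. The denominator is positive unless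
`x₀ = x₁ = a`. -/
noncomputable def hypoThreshold (x₀ x₁ y₁ a : ℝ) : ℝ :=
  √(x₀ ^ 2 * y₁ ^ 2 * (x₁ ^ 2 - x₀ ^ 2) /
    (x₀ ^ 2 * (x₁ ^ 2 - x₀ ^ 2) + (a ^ 2 - x₀ ^ 2) ^ 2))

/-- The threshold `s = min {√(q / a²), √(p / (r - a²))}`, where the second term counts as `+∞`
if `r = a²`. -/
noncomputable def subThreshold (p q r a : ℝ) : ℝ :=
  if r = a ^ 2 then √(q / a ^ 2) else min √(q / a ^ 2) √(p / (r - a ^ 2))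

/-! Write `A = (a y₀)²` and `r = ∫ 1/t dη₁`. The moments of the pair are those of `x` on the
horizontal axis, those of `y` on the vertical axis, and the constant `A` at every index with both
coordinates positive. So a Berger measure of the pair can only live on the two axes and at `(1,1)`,
where its mass is `A`. Contractivity bounds the weights next to the axes by `1`; in the limit this
gives `ξ{1} ≥ A` and `η₁{1} ≥ a²`.

Subnormality holds exactly when `y₀² (r - a²) ≤ p` (`DiagramData.isJointlySubnormal_iff`). The
candidate measure is `ξ - Aδ₁ - pδ₀` on the horizontal axis, `y₀² (dη₁/t - a²δ₁)` on the vertical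
axis, `Aδ` at `(1,1)`, and the remaining mass `p - y₀² (r - a²)` at the origin. The atom bounds make
the axis parts positive, so only the origin can fail. Sufficiency then comes from a model: a measure
on the unit square times Haar measure on the torus yields a normal extension by multiplication
operators. For necessity, apply a commuting normal extension to the vacuum vector: the alternating
sums with coefficients of `(1-s)^{2n} (1-t)^{2n}` are squared norms, and their limit is the origin
mass. The same argument for `T₂` alone shows that `1/t` is `η₁`-integrable.

Joint hyponormality is equivalent to a `2 × 2` determinant condition at each lattice point
(`ShiftWeights.isJointlyHyponormal_pair_iff`). Off the origin it is automatic: inside because all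
weights are `1`, on the axes because a moment sequence stays log-convex after part of the atom at
`1` is removed. At the origin it reads `y₀ ≤ h`, unless `x₀ = x₁ = a`.

Finally, `ξ{1} ≥ A` says `y₀ ≤ √(q/a²)`, so `s < y₀` is decided by the second term of the minimum
and is precisely non-subnormality. If `x₀ = x₁ = a`, then `r = a²`, the pair is subnormal and both
sides of the equivalence fail. -/

/-! ## Multiplication operators on `L²` -/

section MulOp

open ComplexConjugate

variable {X : Type*} [MeasurableSpace X]

/-- Multiplication by a bounded measurable function, as an operator on `L²(ν)`. -/
noncomputable def mulOp (ν : Measure X) (φ : X → ℂ) (hφ : MemLp φ ⊤ ν) :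
    Lp ℂ 2 ν →L[ℂ] Lp ℂ 2 ν :=
  (ContinuousLinearMap.mul ℂ ℂ).holderL ν ⊤ 2 2 hφ.toLp

theorem coeFn_mulOp (ν : Measure X) (φ : X → ℂ) (hφ : MemLp φ ⊤ ν) (f : Lp ℂ 2 ν) :
    mulOp ν φ hφ f =ᵐ[ν] fun x => φ x * f x := by
  have h := (ContinuousLinearMap.mul ℂ ℂ).coeFn_holder (r := 2) hφ.toLp f
  filter_upwards [h, hφ.coeFn_toLp] with x hx hx'
  rw [← hx']
  exact hx

theorem mulOp_commute (ν : Measure X) (φ ψ : X → ℂ) (hφ : MemLp φ ⊤ ν) (hψ : MemLp ψ ⊤ ν) :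
    Commute (mulOp ν φ hφ) (mulOp ν ψ hψ) := by
  ext1 f
  apply Lp.ext
  change mulOp ν φ hφ (mulOp ν ψ hψ f) =ᵐ[ν] mulOp ν ψ hψ (mulOp ν φ hφ f)
  filter_upwards [coeFn_mulOp ν φ hφ f, coeFn_mulOp ν ψ hψ f,
    coeFn_mulOp ν φ hφ (mulOp ν ψ hψ f), coeFn_mulOp ν ψ hψ (mulOp ν φ hφ f)] with x h1 h2 h3 h4
  rw [h3, h4, h1, h2]
  ring

theorem adjoint_mulOp (ν : Measure X) (φ : X → ℂ) (hφ : MemLp φ ⊤ ν)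
    (hφ' : MemLp (fun x => conj (φ x)) ⊤ ν) :
    ContinuousLinearMap.adjoint (mulOp ν φ hφ) = mulOp ν (fun x => conj (φ x)) hφ' := by
  symm
  rw [ContinuousLinearMap.eq_adjoint_iff]
  intro f g
  rw [L2.inner_def, L2.inner_def]
  apply integral_congr_ae
  filter_upwards [coeFn_mulOp ν φ hφ g, coeFn_mulOp ν _ hφ' f] with x h1 h2
  rw [h1, h2]
  simp only [RCLike.inner_apply, map_mul, RCLike.conj_conj]
  ring

theorem isStarNormal_mulOp (ν : Measure X) (φ : X → ℂ) (hφ : MemLp φ ⊤ ν) :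
    IsStarNormal (mulOp ν φ hφ) := by
  have hφ' : MemLp (fun x => conj (φ x)) ⊤ ν := hφ.star
  refine ⟨?_⟩
  rw [ContinuousLinearMap.star_eq_adjoint, adjoint_mulOp ν φ hφ hφ']
  exact mulOp_commute ν _ _ hφ' hφ

theorem mulOp_toLp (ν : Measure X) (φ f g : X → ℂ) (hφ : MemLp φ ⊤ ν) (hf : MemLp f 2 ν)
    (hg : MemLp g 2 ν) (h : ∀ x, φ x * f x = g x) :
    mulOp ν φ hφ (hf.toLp f) = hg.toLp g := by
  apply Lp.ext
  filter_upwards [coeFn_mulOp ν φ hφ (hf.toLp f), hf.coeFn_toLp, hg.coeFn_toLp] with x h1 h2 h3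
  rw [h1, h2, h3, h]

end MulOp

/-! ## Subnormality from an orthonormal family in a larger space -/

/-- The isometry `e_k ↦ v k` intertwines the shifts with `N`; bounded operators on `ℓ²` are
determined by their values on basis vectors, so this is checked there. -/
theorem ShiftWeights.isJointlySubnormal_of_orthonormal (W : ShiftWeights)
    {K : Type} [NormedAddCommGroup K] [InnerProductSpace ℂ K] [CompleteSpace K]
    (v : ℕ × ℕ → K) (hv : Orthonormal ℂ v) (N : Fin 2 → (K →L[ℂ] K))
    (hc : Commute (N 0) (N 1)) (hn : ∀ i, IsStarNormal (N i))
    (h₁ : ∀ k, N 0 (v k) = (W.α k : ℂ) • v (k + (1, 0)))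
    (h₂ : ∀ k, N 1 (v k) = (W.β k : ℂ) • v (k + (0, 1))) : IsJointlySubnormal W.pair := by
  have key : ∀ A B : lp (fun _ : ℕ × ℕ => ℂ) 2 →L[ℂ] K,
      (∀ k, A (lp.single 2 k 1) = B (lp.single 2 k 1)) → A = B := by
    intro A B h
    ext1 f
    have hf := lp.hasSum_single (p := 2) (by norm_num) f
    have e : ∀ k, A (lp.single 2 k (f k)) = B (lp.single 2 k (f k)) := by
      intro k
      have : lp.single 2 k (f k) = f k • lp.single (E := fun _ : ℕ × ℕ => ℂ) 2 k (1 : ℂ) := by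
        rw [← lp.single_smul]; simp
      rw [this, map_smul, map_smul, h]
    have hA := A.hasSum hf
    have hB := B.hasSum hf
    simp only [e] at hA
    exact hA.unique hB
  refine ⟨K, inferInstance, inferInstance, inferInstance, hv.orthogonalFamily.linearIsometry, N,
    ?_, hn, ?_⟩
  · intro i j
    fin_cases i <;> fin_cases j
    exacts [Commute.refl _, hc, hc.symm, Commute.refl _]
  · have hV : ∀ k, hv.orthogonalFamily.linearIsometry (lp.single 2 k (1 : ℂ)) = v k := by
      intro k
      rw [OrthogonalFamily.linearIsometry_apply_single]
      simp
    intro i f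
    have := key (N i ∘L hv.orthogonalFamily.linearIsometry.toContinuousLinearMap)
      (hv.orthogonalFamily.linearIsometry.toContinuousLinearMap ∘L W.pair i) (by
        intro k
        simp only [ContinuousLinearMap.comp_apply, LinearIsometry.coe_toContinuousLinearMap]
        fin_cases i
        · change N 0 _ = hv.orthogonalFamily.linearIsometry (W.T₁ _)
          rw [ShiftWeights.T₁, weightedShift_single, map_smul, hV, hV, h₁]
          rfl
        · change N 1 _ = hv.orthogonalFamily.linearIsometry (W.T₂ _)
          rw [ShiftWeights.T₂, weightedShift_single, map_smul, hV, hV, h₂]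
          rfl)
    exact congrArg (fun A => A f) this

/-- The normalized monomials `φ^{k₁} ψ^{k₂} / √γ_k` form an orthonormal family in `L²(ν)` that
multiplication by `φ` and `ψ` shifts with weights `α` and `β`. -/
theorem ShiftWeights.isJointlySubnormal_of_multiplication (W : ShiftWeights) {X : Type}
    [MeasurableSpace X] (ν : Measure X) [IsFiniteMeasure ν] (φ ψ : X → ℂ) (hφ : Measurable φ)
    (hψ : Measurable ψ) (hφb : ∀ x, ‖φ x‖ ≤ 1) (hψb : ∀ x, ‖ψ x‖ ≤ 1) (γ : ℕ × ℕ → ℝ)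
    (hγ : ∀ k, 0 < γ k) (h₁ : ∀ k, γ (k + (1, 0)) = W.α k ^ 2 * γ k)
    (h₂ : ∀ k, γ (k + (0, 1)) = W.β k ^ 2 * γ k)
    (horth : ∀ k l : ℕ × ℕ, ∫ x, (starRingEnd ℂ) (φ x ^ k.1 * ψ x ^ k.2) *
      (φ x ^ l.1 * ψ x ^ l.2) ∂ν = if k = l then (γ k : ℂ) else 0) :
    IsJointlySubnormal W.pair := by
  have hmem : ∀ k : ℕ × ℕ, MemLp (fun x => φ x ^ k.1 * ψ x ^ k.2) 2 ν := by
    intro k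
    refine MemLp.of_bound (by fun_prop) 1 (Filter.Eventually.of_forall fun x => ?_)
    rw [norm_mul, norm_pow, norm_pow]
    exact mul_le_one₀ (pow_le_one₀ (norm_nonneg _) (hφb x)) (by positivity)
      (pow_le_one₀ (norm_nonneg _) (hψb x))
  have hφm : MemLp φ ⊤ ν := MemLp.of_bound (by fun_prop) 1 (Filter.Eventually.of_forall hφb)
  have hψm : MemLp ψ ⊤ ν := MemLp.of_bound (by fun_prop) 1 (Filter.Eventually.of_forall hψb)
  set v : ℕ × ℕ → Lp ℂ 2 ν := fun k => (((√(γ k))⁻¹ : ℝ) : ℂ) • (hmem k).toLp _ with hvdef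
  -- Renormalizing from index `k` to its neighbour `l` produces exactly the shift weight.
  have scal : ∀ (k l : ℕ × ℕ) (w : ℝ), 0 < w → γ l = w ^ 2 * γ k →
      (((√(γ k))⁻¹ : ℝ) : ℂ) = (w : ℂ) * (((√(γ l))⁻¹ : ℝ) : ℂ) := by
    intro k l w hw h
    rw [← Complex.ofReal_mul, h, Real.sqrt_mul (by positivity), Real.sqrt_sq hw.le]
    have := Real.sqrt_pos.2 (hγ k)
    congr 1
    field_simp
  refine W.isJointlySubnormal_of_orthonormal v ?_ ![mulOp ν φ hφm, mulOp ν ψ hψm]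
    (mulOp_commute ν _ _ _ _) ?_ ?_ ?_
  · rw [orthonormal_iff_ite]
    intro k l
    rw [hvdef, inner_smul_left, inner_smul_right, L2.inner_def]
    have : ∫ x, inner ℂ (((hmem k).toLp _ : Lp ℂ 2 ν) x) (((hmem l).toLp _ : Lp ℂ 2 ν) x) ∂ν =
        if k = l then (γ k : ℂ) else 0 := by
      rw [← horth k l]
      apply integral_congr_ae
      filter_upwards [(hmem k).coeFn_toLp, (hmem l).coeFn_toLp] with x h1 h2
      rw [h1, h2, RCLike.inner_apply, mul_comm]
    rw [this]
    split_ifs with h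
    · subst h
      rw [Complex.conj_ofReal, ← Complex.ofReal_mul, ← Complex.ofReal_mul, ← Complex.ofReal_one]
      congr 1
      have h0 := Real.sqrt_pos.2 (hγ k)
      have h1 := Real.mul_self_sqrt (hγ k).le
      field_simp
      nlinarith
    · simp
  · intro i
    fin_cases i
    · exact isStarNormal_mulOp ν _ _
    · exact isStarNormal_mulOp ν _ _
  · intro k
    change mulOp ν φ hφm _ = _
    rw [hvdef]
    simp only
    rw [map_smul, mulOp_toLp ν φ _ _ hφm (hmem k) (hmem (k + (1, 0)))
      (by intro x; simp only [Prod.fst_add, Prod.snd_add]; ring), smul_smul,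
      scal k _ _ (W.α_pos k) (h₁ k)]
  · intro k
    change mulOp ν ψ hψm _ = _
    rw [hvdef]
    simp only
    rw [map_smul, mulOp_toLp ν ψ _ _ hψm (hmem k) (hmem (k + (0, 1)))
      (by intro x; simp only [Prod.fst_add, Prod.snd_add]; ring), smul_smul,
      scal k _ _ (W.β_pos k) (h₂ k)]

/-! ### Characters of the circle and the torus model. -/

theorem integral_fourier_haarAddCircle (n : ℤ) :
    ∫ x, fourier n x ∂(AddCircle.haarAddCircle (T := (1 : ℝ))) = if n = 0 then 1 else 0 := by
  have h := congrFun (fourierCoeff_fourier (T := (1 : ℝ)) n) 0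
  rw [fourierCoeff] at h
  simp only [neg_zero, fourier_zero, one_smul] at h
  rw [h, Pi.single_apply]
  simp [eq_comm]

theorem integral_conj_pow_mul_pow_fourier (k l : ℕ) :
    ∫ x, (starRingEnd ℂ) (fourier 1 x ^ k) * fourier 1 x ^ l
      ∂(AddCircle.haarAddCircle (T := (1 : ℝ))) = if k = l then 1 else 0 := by
  have hp : ∀ (m : ℕ) (x : AddCircle (1 : ℝ)), (fourier 1 x : ℂ) ^ m = fourier (m : ℤ) x := by
    intro m x
    induction m with
    | zero => simp
    | succ m ih => rw [pow_succ, ih, Nat.cast_succ, fourier_add]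
  have h : ∀ x : AddCircle (1 : ℝ), (starRingEnd ℂ) (fourier 1 x ^ k) * fourier 1 x ^ l =
      fourier ((l : ℤ) - k) x := by
    intro x
    rw [hp, hp, ← fourier_neg, ← fourier_add]
    congr 2
    ring
  simp_rw [h]
  rw [integral_fourier_haarAddCircle]
  congr 1
  rw [sub_eq_zero, Nat.cast_inj]
  exact propext eq_comm

/-- A pair of weighted shifts whose moments are those of a measure on the unit square is
subnormal. -/
theorem ShiftWeights.isJointlySubnormal_of_measure (W : ShiftWeights) (μ : Measure (ℝ × ℝ))
    [IsFiniteMeasure μ] (hμ : ∀ᵐ z ∂μ, z.1 ∈ Set.Icc (0 : ℝ) 1 ∧ z.2 ∈ Set.Icc (0 : ℝ) 1)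
    (γ : ℕ × ℕ → ℝ)
    (hγ : ∀ k, 0 < γ k) (h₁ : ∀ k, γ (k + (1, 0)) = W.α k ^ 2 * γ k)
    (h₂ : ∀ k, γ (k + (0, 1)) = W.β k ^ 2 * γ k)
    (hm : ∀ k : ℕ × ℕ, ∫ z, z.1 ^ k.1 * z.2 ^ k.2 ∂μ = γ k) :
    IsJointlySubnormal W.pair := by
  -- The square root of `t` clamped to `[0,1]`, so that the multipliers are bounded everywhere and
  -- not only almost everywhere. The multipliers are polar: radii `√s`, `√t` carry the moments, and
  -- the two independent angles give orthogonality.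
  let c : ℝ → ℝ := fun t => √(max 0 (min t 1))
  have hcm : Measurable c := by fun_prop
  have hc0 : ∀ t, 0 ≤ c t := fun t => Real.sqrt_nonneg _
  have hc1 : ∀ t, c t ≤ 1 := fun t => by
    exact Real.sqrt_le_one.2 (max_le zero_le_one (min_le_right _ _))
  have hcs : ∀ t ∈ Set.Icc (0 : ℝ) 1, c t * c t = t := by
    intro t ht
    simp only [c]
    rw [min_eq_left ht.2, max_eq_right ht.1, Real.mul_self_sqrt ht.1]
  let θ := AddCircle.haarAddCircle (T := (1 : ℝ))
  let φ : (ℝ × ℝ) × (AddCircle (1 : ℝ) × AddCircle (1 : ℝ)) → ℂ :=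
    fun x => (c x.1.1 : ℂ) * fourier 1 x.2.1
  let ψ : (ℝ × ℝ) × (AddCircle (1 : ℝ) × AddCircle (1 : ℝ)) → ℂ :=
    fun x => (c x.1.2 : ℂ) * fourier 1 x.2.2
  have hF : Measurable (fun x : AddCircle (1 : ℝ) => (fourier 1 x : ℂ)) :=
    (map_continuous (fourier 1)).measurable
  have hb : ∀ (t : ℝ) (x : AddCircle (1 : ℝ)), ‖(c t : ℂ) * fourier 1 x‖ ≤ 1 := by
    intro t x
    rw [norm_mul, Complex.norm_real, Real.norm_of_nonneg (hc0 t), fourier_apply, Circle.norm_coe,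
      mul_one]
    exact hc1 t
  refine W.isJointlySubnormal_of_multiplication (μ.prod (θ.prod θ)) φ ψ ?_ ?_ (fun x => hb _ _)
    (fun x => hb _ _) γ hγ h₁ h₂ ?_
  · exact (Complex.measurable_ofReal.comp (hcm.comp (by fun_prop))).mul (hF.comp (by fun_prop))
  · exact (Complex.measurable_ofReal.comp (hcm.comp (by fun_prop))).mul (hF.comp (by fun_prop))
  intro k l
  have e : ∀ x : (ℝ × ℝ) × (AddCircle (1 : ℝ) × AddCircle (1 : ℝ)),
      (starRingEnd ℂ) (φ x ^ k.1 * ψ x ^ k.2) * (φ x ^ l.1 * ψ x ^ l.2) =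
      ((c x.1.1 ^ k.1 * c x.1.1 ^ l.1 * (c x.1.2 ^ k.2 * c x.1.2 ^ l.2) : ℝ) : ℂ) *
      (((starRingEnd ℂ) (fourier 1 x.2.1 ^ k.1) * fourier 1 x.2.1 ^ l.1) *
       ((starRingEnd ℂ) (fourier 1 x.2.2 ^ k.2) * fourier 1 x.2.2 ^ l.2)) := by
    intro x
    simp only [φ, ψ, map_mul, map_pow, Complex.conj_ofReal]
    push_cast
    ring
  simp_rw [e]
  rw [integral_prod_mul (μ := μ) (ν := θ.prod θ)
    (fun z : ℝ × ℝ => ((c z.1 ^ k.1 * c z.1 ^ l.1 * (c z.2 ^ k.2 * c z.2 ^ l.2) : ℝ) : ℂ))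
    (fun w : AddCircle (1 : ℝ) × AddCircle (1 : ℝ) =>
      ((starRingEnd ℂ) (fourier 1 w.1 ^ k.1) * fourier 1 w.1 ^ l.1) *
       ((starRingEnd ℂ) (fourier 1 w.2 ^ k.2) * fourier 1 w.2 ^ l.2)),
    integral_prod_mul (μ := θ) (ν := θ)
      (fun w : AddCircle (1 : ℝ) => (starRingEnd ℂ) (fourier 1 w ^ k.1) * fourier 1 w ^ l.1)
      (fun w : AddCircle (1 : ℝ) => (starRingEnd ℂ) (fourier 1 w ^ k.2) * fourier 1 w ^ l.2),
    integral_conj_pow_mul_pow_fourier, integral_conj_pow_mul_pow_fourier]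
  by_cases hkl : k = l
  · subst hkl
    simp only [if_true, mul_one]
    rw [integral_complex_ofReal, ← hm k]
    congr 1
    apply integral_congr_ae
    filter_upwards [hμ] with z hz
    rw [← mul_pow, ← mul_pow, hcs _ hz.1, hcs _ hz.2]
  · rw [if_neg hkl]
    have : ¬ (k.1 = l.1 ∧ k.2 = l.2) := fun h => hkl (Prod.ext h.1 h.2)
    by_cases h1 : k.1 = l.1
    · rw [if_neg (fun h2 => this ⟨h1, h2⟩)]; simp
    · rw [if_neg h1]; simp

/-! ## Positivity of alternating sums of moments -/

section Positivity

/-- The coefficient of `Xⁱ` in `(1 - X) ^ m`. -/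
def altCoeff (m i : ℕ) : ℝ := (-1) ^ i * (m.choose i : ℝ)

variable {K : Type*} [NormedAddCommGroup K] [InnerProductSpace ℂ K]

theorem one_sub_pow_eq_sum_altCoeff (Q : K →L[ℂ] K) (m : ℕ) :
    (1 - Q) ^ m = ∑ i ∈ Finset.range (m + 1), (altCoeff m i : ℂ) • Q ^ i := by
  rw [sub_eq_neg_add, (Commute.one_right (-Q)).add_pow]
  refine Finset.sum_congr rfl fun i _ => ?_
  have hn : ((m.choose i : ℕ) : K →L[ℂ] K) = ((m.choose i : ℕ) : ℂ) • 1 := by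
    rw [Nat.cast_smul_eq_nsmul, nsmul_one]
  rw [one_pow, mul_one, neg_pow, altCoeff, hn, mul_smul_comm, mul_one]
  push_cast
  rcases Nat.even_or_odd i with h | h
  · rw [h.neg_one_pow, h.neg_one_pow, one_mul, one_mul]
  · rw [h.neg_one_pow, h.neg_one_pow, neg_one_mul, neg_one_mul, neg_smul, smul_neg]

/-- The sum is `‖(1-Q)^n (1-R)^n v‖²`. The even exponent `2n` makes it a square, so no bound on the
spectra of `Q` and `R` is needed. -/
theorem sum_altCoeff_nonneg_of_isSelfAdjoint [CompleteSpace K] (Q R : K →L[ℂ] K) (hQ : IsSelfAdjoint Q)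
    (hR : IsSelfAdjoint R) (hQR : Commute Q R) (v : K) (γ : ℕ → ℕ → ℝ)
    (hγ : ∀ i j, inner ℂ v ((Q ^ i * R ^ j) v) = (γ i j : ℂ)) (n : ℕ) :
    0 ≤ ∑ i ∈ Finset.range (2 * n + 1), ∑ j ∈ Finset.range (2 * n + 1),
      altCoeff (2 * n) i * altCoeff (2 * n) j * γ i j := by
  set P := (1 - Q) ^ n * (1 - R) ^ n with hP
  have hc : Commute ((1 - Q) ^ n) ((1 - R) ^ n) :=
    ((Commute.one_left _).sub_left ((Commute.one_right _).sub_right hQR)).pow_pow n n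
  have hPs : ContinuousLinearMap.adjoint P = P := by
    rw [← ContinuousLinearMap.star_eq_adjoint, hP, star_mul, star_pow, star_pow, star_sub,
      star_sub, star_one, hQ.star_eq, hR.star_eq, hc.eq]
  have hPP : P * P = (1 - Q) ^ (2 * n) * (1 - R) ^ (2 * n) := by
    rw [hP, hc.symm.mul_mul_mul_comm, ← pow_add, ← pow_add, two_mul]
  have h1 : inner ℂ v ((P * P) v) = ((‖P v‖ ^ 2 : ℝ) : ℂ) := by
    rw [ContinuousLinearMap.mul_def, ContinuousLinearMap.comp_apply, ← ContinuousLinearMap.adjoint_inner_left, hPs,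
      inner_self_eq_norm_sq_to_K]
    simp
  rw [hPP, one_sub_pow_eq_sum_altCoeff, one_sub_pow_eq_sum_altCoeff, Finset.sum_mul_sum] at h1
  simp only [sum_apply, inner_sum, smul_mul_smul_comm,
    smul_apply, inner_smul_right, hγ] at h1
  have h2 : ∑ i ∈ Finset.range (2 * n + 1), ∑ j ∈ Finset.range (2 * n + 1),
      altCoeff (2 * n) i * altCoeff (2 * n) j * γ i j = ‖P v‖ ^ 2 := by
    exact_mod_cast h1
  rw [h2]
  positivity

theorem sum_altCoeff_nonneg_of_isStarNormal [CompleteSpace K] (M N : K →L[ℂ] K) (hM : IsStarNormal M)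
    (hN : IsStarNormal N) (hMN : Commute M N) (v : K) (n : ℕ) :
    0 ≤ ∑ i ∈ Finset.range (2 * n + 1), ∑ j ∈ Finset.range (2 * n + 1),
      altCoeff (2 * n) i * altCoeff (2 * n) j * ‖(M ^ i * N ^ j) v‖ ^ 2 := by
  -- Fuglede's theorem: a normal operator's adjoint commutes with whatever the operator commutes
  -- with. Hence `M*M` and `N*N` commute.
  have h1 : Commute (star M) N := hM.commute_star_left hMN
  have h2 : Commute M (star N) := hN.commute_star_right hMN
  have h3 : Commute (star M) (star N) := hMN.star_star
  have hc : Commute (star M * M) (star N * N) :=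
    (h3.mul_right h1).mul_left (h2.mul_right hMN)
  refine sum_altCoeff_nonneg_of_isSelfAdjoint (star M * M) (star N * N)
    (IsSelfAdjoint.star_mul_self M) (IsSelfAdjoint.star_mul_self N) hc v _ (fun i j => ?_) n
  have e : (star M * M) ^ i * (star N * N) ^ j = star (M ^ i * N ^ j) * (M ^ i * N ^ j) := by
    rw [hM.star_comm_self.mul_pow, hN.star_comm_self.mul_pow,
      (h2.pow_pow i j).mul_mul_mul_comm, star_mul, star_pow, star_pow, (h3.pow_pow i j).eq]
  rw [e, ContinuousLinearMap.mul_def, ContinuousLinearMap.comp_apply, ContinuousLinearMap.star_eq_adjoint,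
    ContinuousLinearMap.adjoint_inner_right, inner_self_eq_norm_sq_to_K]
  simp

end Positivity

/-! ### Moments of a 2-variable shift and necessary conditions for subnormality. -/

namespace ShiftWeights

theorem T₁_pow_single (W : ShiftWeights) (i j : ℕ) :
    (W.T₁ ^ i) (lp.single 2 (0, j) (1 : ℂ)) =
      ((∏ l ∈ Finset.range i, W.α (l, j) : ℝ) : ℂ) • lp.single 2 (i, j) (1 : ℂ) := by
  induction i with
  | zero => simp
  | succ i ih =>
    rw [pow_succ', ContinuousLinearMap.mul_def, ContinuousLinearMap.comp_apply, ih, map_smul, T₁, weightedShift_single,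
      smul_smul, Finset.prod_range_succ, Complex.ofReal_mul]
    rfl

theorem T₂_pow_single (W : ShiftWeights) (j : ℕ) :
    (W.T₂ ^ j) (lp.single 2 (0, 0) (1 : ℂ)) =
      ((∏ l ∈ Finset.range j, W.β (0, l) : ℝ) : ℂ) • lp.single 2 (0, j) (1 : ℂ) := by
  induction j with
  | zero => simp
  | succ i ih =>
    rw [pow_succ', ContinuousLinearMap.mul_def, ContinuousLinearMap.comp_apply, ih, map_smul, T₂, weightedShift_single,
      smul_smul, Finset.prod_range_succ, Complex.ofReal_mul]
    rfl

/-- The moments of a 2-variable weighted shift, along the path that first goes up. -/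
noncomputable def moment (W : ShiftWeights) (i j : ℕ) : ℝ :=
  (∏ l ∈ Finset.range j, W.β (0, l) ^ 2) * ∏ l ∈ Finset.range i, W.α (l, j) ^ 2

theorem norm_pow_single_sq (W : ShiftWeights) (i j : ℕ) :
    ‖(W.T₁ ^ i * W.T₂ ^ j) (lp.single 2 (0, 0) (1 : ℂ))‖ ^ 2 = W.moment i j := by
  rw [ContinuousLinearMap.mul_def, ContinuousLinearMap.comp_apply, T₂_pow_single, map_smul, T₁_pow_single, norm_smul,
    norm_smul, lp.norm_single (by norm_num), norm_one, mul_one, Complex.norm_real,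
    Complex.norm_real, mul_pow, Real.norm_eq_abs, Real.norm_eq_abs, sq_abs, sq_abs, moment,
    Finset.prod_pow, Finset.prod_pow]

theorem sum_altCoeff_moment_nonneg (W : ShiftWeights) (h : IsJointlySubnormal W.pair) (n : ℕ) :
    0 ≤ ∑ i ∈ Finset.range (2 * n + 1), ∑ j ∈ Finset.range (2 * n + 1),
      altCoeff (2 * n) i * altCoeff (2 * n) j * W.moment i j := by
  obtain ⟨K, _, _, _, V, N, hc, hn, hV⟩ := h
  have hp : ∀ (b : Fin 2) (m : ℕ) f, (N b ^ m) (V f) = V ((W.pair b ^ m) f) := by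
    intro b m
    induction m with
    | zero => intro f; simp
    | succ m ih => intro f; rw [pow_succ, pow_succ, ContinuousLinearMap.mul_def, ContinuousLinearMap.comp_apply, hV, ih]; rfl
  have key := sum_altCoeff_nonneg_of_isStarNormal (N 0) (N 1) (hn 0) (hn 1) (hc 0 1)
    (V (lp.single 2 (0, 0) (1 : ℂ))) n
  have e : ∀ i j, ‖(N 0 ^ i * N 1 ^ j) (V (lp.single 2 (0, 0) (1 : ℂ)))‖ ^ 2 = W.moment i j := by
    intro i j
    rw [← W.norm_pow_single_sq, ContinuousLinearMap.mul_def, ContinuousLinearMap.comp_apply, hp, hp, LinearIsometry.norm_map]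
    rfl
  simpa only [e] using key

theorem sum_altCoeff_moment_zero_nonneg (W : ShiftWeights) (h : IsSubnormalOperator W.T₂)
    (n : ℕ) :
    0 ≤ ∑ j ∈ Finset.range (2 * n + 1), altCoeff (2 * n) j * W.moment 0 j := by
  obtain ⟨K, _, _, _, V, N, hc, hn, hV⟩ := h
  have hp : ∀ (m : ℕ) f, (N () ^ m) (V f) = V ((W.T₂ ^ m) f) := by
    intro m
    induction m with
    | zero => intro f; simp
    | succ m ih => intro f; rw [pow_succ, pow_succ, ContinuousLinearMap.mul_def, ContinuousLinearMap.comp_apply, hV, ih]; rfl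
  -- Taking the first operator to be `0` leaves only the terms with `i = 0`, which is the
  -- one-variable statement.
  have key := sum_altCoeff_nonneg_of_isStarNormal 0 (N ()) inferInstance (hn ())
    (Commute.zero_left _) (V (lp.single 2 (0, 0) (1 : ℂ))) n
  rw [Finset.sum_range_succ', Finset.sum_eq_zero, zero_add] at key
  · refine key.trans_eq (Finset.sum_congr rfl fun j _ => ?_)
    rw [← W.norm_pow_single_sq, pow_zero, one_mul, hp, LinearIsometry.norm_map]
    simp [altCoeff]
  · intro i _
    refine Finset.sum_eq_zero fun j _ => ?_
    simp

end ShiftWeights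

/-! ## Measures on the unit interval -/

section UnitInterval

open Filter Topology

variable {μ : Measure ℝ}

theorem integral_ite_eq_measureReal (c : ℝ) :
    ∫ t, (if t = c then (1 : ℝ) else 0) ∂μ = μ.real {c} := by
  have : (fun t : ℝ => if t = c then (1 : ℝ) else 0) = Set.indicator {c} 1 := by
    ext t; simp [Set.indicator_apply]
  rw [this, integral_indicator_one (measurableSet_singleton c)]

variable [IsFiniteMeasure μ]

theorem integrable_ite_eq (c : ℝ) : Integrable (fun t => if t = c then (1 : ℝ) else 0) μ := by
  refine Integrable.of_bound ?_ 1 (ae_of_all _ fun t => ?_)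
  · exact (Measurable.ite (measurableSet_singleton c) measurable_const
      measurable_const).aestronglyMeasurable
  · split_ifs <;> simp

theorem integrable_of_continuous_of_ae_mem_Icc (hμ : ∀ᵐ t ∂μ, t ∈ Set.Icc (0 : ℝ) 1) {f : ℝ → ℝ}
    (hf : Continuous f) : Integrable f μ := by
  obtain ⟨C, hC⟩ := isCompact_Icc.exists_bound_of_continuousOn (s := Set.Icc (0 : ℝ) 1)
    hf.continuousOn
  exact Integrable.of_bound hf.aestronglyMeasurable C (hμ.mono fun t ht => hC t ht)

theorem tendsto_integral_pow (hμ : ∀ᵐ t ∂μ, t ∈ Set.Icc (0 : ℝ) 1) :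
    Tendsto (fun n : ℕ => ∫ t, t ^ n ∂μ) atTop (𝓝 (μ.real {1})) := by
  rw [← integral_ite_eq_measureReal]
  refine tendsto_integral_of_dominated_convergence (fun _ => 1) (fun n => by fun_prop)
    (integrable_const _) (fun n => hμ.mono fun t ht => ?_) (hμ.mono fun t ht => ?_)
  · rw [Real.norm_of_nonneg (pow_nonneg ht.1 n)]
    exact pow_le_one₀ ht.1 ht.2
  · split_ifs with h
    · simp [h]
    · exact tendsto_pow_atTop_nhds_zero_of_lt_one ht.1 (lt_of_le_of_ne ht.2 h)

theorem tendsto_integral_one_sub_pow (hμ : ∀ᵐ t ∂μ, t ∈ Set.Icc (0 : ℝ) 1) :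
    Tendsto (fun n : ℕ => ∫ t, (1 - t) ^ n ∂μ) atTop (𝓝 (μ.real {0})) := by
  rw [← integral_ite_eq_measureReal]
  refine tendsto_integral_of_dominated_convergence (fun _ => 1) (fun n => by fun_prop)
    (integrable_const _) (fun n => hμ.mono fun t ht => ?_) (hμ.mono fun t ht => ?_)
  · rw [Real.norm_of_nonneg (pow_nonneg (sub_nonneg.2 ht.2) n)]
    exact pow_le_one₀ (sub_nonneg.2 ht.2) (by linarith [ht.1])
  · split_ifs with h
    · simp [h]
    · refine tendsto_pow_atTop_nhds_zero_of_lt_one (sub_nonneg.2 ht.2) ?_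
      have := lt_of_le_of_ne ht.1 (Ne.symm h)
      linarith

/-- Removing from a measure on `[0, 1]` part of its atom at `1` keeps the moments log-convex. -/
theorem moment_sub_sq_le (hμ : ∀ᵐ t ∂μ, t ∈ Set.Icc (0 : ℝ) 1) {A : ℝ} (hA : A ≤ μ.real {1})
    (k : ℕ) :
    (∫ t, t ^ (k + 1) ∂μ - A) ^ 2 ≤ (∫ t, t ^ k ∂μ - A) * (∫ t, t ^ (k + 2) ∂μ - A) := by
  have hi : ∀ {f : ℝ → ℝ}, Continuous f → Integrable f μ :=
    fun hf => integrable_of_continuous_of_ae_mem_Icc hμ hf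
  -- The quadratic in `l` is `∫ t^k (t-l)² dμ - A (1-l)²`; the atom at `1` alone contributes `μ{1}
  -- (1-l)²` to the integral. The claim is its discriminant inequality.
  have key : ∀ l : ℝ, 0 ≤ (∫ t, t ^ k ∂μ - A) * (l * l) +
      (-2 * (∫ t, t ^ (k + 1) ∂μ - A)) * l + (∫ t, t ^ (k + 2) ∂μ - A) := by
    intro l
    have h1 : μ.real {1} * (1 - l) ^ 2 ≤ ∫ t, t ^ k * (t - l) ^ 2 ∂μ := by
      rw [← integral_ite_eq_measureReal, ← integral_mul_const]
      refine integral_mono_ae ((integrable_ite_eq 1).mul_const _) (hi (by fun_prop))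
        (hμ.mono fun t ht => ?_)
      have := ht.1
      simp only
      split_ifs with h
      · simp [h]
      · simp only [zero_mul]; positivity
    have h2 : ∫ t, t ^ k * (t - l) ^ 2 ∂μ =
        ∫ t, t ^ (k + 2) ∂μ - 2 * l * ∫ t, t ^ (k + 1) ∂μ + l ^ 2 * ∫ t, t ^ k ∂μ := by
      rw [← integral_const_mul, ← integral_const_mul, ← integral_sub (hi (by fun_prop))
        (hi (by fun_prop)), ← integral_add (hi (by fun_prop)) (hi (by fun_prop))]
      congr 1
      ext t
      ring
    nlinarith [mul_le_mul_of_nonneg_right hA (sq_nonneg (1 - l))]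
  have := discrim_le_zero key
  rw [discrim] at this
  nlinarith

theorem measureReal_one_le_integral_pow (hμ : ∀ᵐ t ∂μ, t ∈ Set.Icc (0 : ℝ) 1) (k : ℕ) :
    μ.real {1} ≤ ∫ t, t ^ k ∂μ := by
  rw [← integral_ite_eq_measureReal]
  refine integral_mono_ae (integrable_ite_eq 1)
    (integrable_of_continuous_of_ae_mem_Icc hμ (by fun_prop)) (hμ.mono fun t ht => ?_)
  have := ht.1
  simp only
  split_ifs with h
  · simp [h]
  · positivity

theorem geom_sum_one_sub_le {t : ℝ} (ht : t ∈ Set.Icc (0 : ℝ) 1) (h0 : t ≠ 0) (m : ℕ) :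
    0 ≤ ∑ l ∈ Finset.range m, (1 - t) ^ l ∧
      ∑ l ∈ Finset.range m, (1 - t) ^ l ≤ 1 / t := by
  have h1 : 0 ≤ 1 - t := sub_nonneg.2 ht.2
  have hp : 0 < t := lt_of_le_of_ne ht.1 (Ne.symm h0)
  refine ⟨Finset.sum_nonneg fun l _ => pow_nonneg h1 l, ?_⟩
  rw [le_div_iff₀ hp]
  have := geom_sum_mul_neg (1 - t) m
  rw [sub_sub_cancel] at this
  rw [this]
  linarith [pow_nonneg h1 m]

theorem tendsto_geom_sum_one_sub {t : ℝ} (ht : t ∈ Set.Icc (0 : ℝ) 1) (h0 : t ≠ 0) :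
    Tendsto (fun n : ℕ => ∑ l ∈ Finset.range (2 * n), (1 - t) ^ l) atTop (𝓝 (1 / t)) := by
  have h1 : 0 ≤ 1 - t := sub_nonneg.2 ht.2
  have hp : 0 < t := lt_of_le_of_ne ht.1 (Ne.symm h0)
  have h := (hasSum_geometric_of_lt_one h1 (by linarith)).tendsto_sum_nat
  rw [sub_sub_cancel, ← one_div] at h
  exact h.comp (tendsto_id.const_mul_atTop' (by norm_num))

/-- If the integrals of the partial sums of `∑ (1 - t)ˡ = 1 / t` stay bounded, then `1 / t` is
integrable, and they converge to its integral. -/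
theorem integrable_one_div_of_integral_geom_sum_le (hμ : ∀ᵐ t ∂μ, t ∈ Set.Icc (0 : ℝ) 1) (C : ℝ)
    (hC : ∀ n : ℕ, ∫ t, ∑ l ∈ Finset.range (2 * n), (1 - t) ^ l ∂μ ≤ C) :
    (∀ᵐ t ∂μ, t ≠ 0) ∧ Integrable (fun t => 1 / t) μ ∧
      Tendsto (fun n : ℕ => ∫ t, ∑ l ∈ Finset.range (2 * n), (1 - t) ^ l ∂μ) atTop
        (𝓝 (∫ t, 1 / t ∂μ)) := by
  have hi : ∀ {f : ℝ → ℝ}, Continuous f → Integrable f μ :=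
    fun hf => integrable_of_continuous_of_ae_mem_Icc hμ hf
  have hS0 : ∀ n : ℕ, ∀ t ∈ Set.Icc (0 : ℝ) 1, 0 ≤ ∑ l ∈ Finset.range (2 * n), (1 - t) ^ l :=
    fun n t ht => Finset.sum_nonneg fun l _ => pow_nonneg (sub_nonneg.2 ht.2) l
  -- Every summand is `1` at `t = 0`, so an atom there would contribute `2n μ{0}`, unbounded in `n`.
  -- This needs its own argument: with `1/0 = 0`, integrability of `1/t` does not see such an atom.
  have hzero : μ.real {0} = 0 := by
    by_contra hne
    have hpos : 0 < μ.real {0} := lt_of_le_of_ne measureReal_nonneg (Ne.symm hne)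
    obtain ⟨n, hn⟩ := exists_nat_gt (C / μ.real {0})
    rw [div_lt_iff₀ hpos] at hn
    have h1 : (2 * n : ℝ) * μ.real {0} ≤ C := by
      refine le_trans ?_ (hC n)
      rw [← integral_ite_eq_measureReal, ← integral_const_mul]
      refine integral_mono_ae ((integrable_ite_eq 0).const_mul _) (hi (by fun_prop))
        (hμ.mono fun t ht => ?_)
      simp only
      split_ifs with h
      · simp [h]
      · rw [mul_zero]; exact hS0 n t ht
    nlinarith [mul_nonneg (Nat.cast_nonneg (α := ℝ) n) hpos.le]
  have h0 : ∀ᵐ t ∂μ, t ≠ 0 := by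
    rw [measureReal_eq_zero_iff] at hzero
    rw [ae_iff]
    simpa using hzero
  have hlim : ∀ᵐ t ∂μ, Tendsto (fun n : ℕ => ∑ l ∈ Finset.range (2 * n), (1 - t) ^ l) atTop
      (𝓝 (1 / t)) := by
    filter_upwards [hμ, h0] with t ht ht0 using tendsto_geom_sum_one_sub ht ht0
  have hint : Integrable (fun t : ℝ => 1 / t) μ := by
    have hm : Measurable (fun t : ℝ => 1 / t) := measurable_const.div measurable_id
    refine ⟨hm.aestronglyMeasurable, ?_⟩
    have hnn : 0 ≤ᵐ[μ] fun t : ℝ => 1 / t := hμ.mono fun t ht => one_div_nonneg.2 ht.1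
    rw [hasFiniteIntegral_iff_ofReal hnn]
    refine lt_of_le_of_lt ?_ (ENNReal.ofReal_lt_top (r := C))
    -- Fatou's lemma along the partial sums.
    calc ∫⁻ t, ENNReal.ofReal (1 / t) ∂μ
        = ∫⁻ t, liminf (fun n : ℕ => ENNReal.ofReal
            (∑ l ∈ Finset.range (2 * n), (1 - t) ^ l)) atTop ∂μ := by
          refine lintegral_congr_ae (hlim.mono fun t ht => ?_)
          exact ((ENNReal.continuous_ofReal.tendsto _).comp ht).liminf_eq.symm
      _ ≤ liminf (fun n : ℕ => ∫⁻ t, ENNReal.ofReal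
            (∑ l ∈ Finset.range (2 * n), (1 - t) ^ l) ∂μ) atTop :=
          lintegral_liminf_le fun n => by fun_prop
      _ ≤ ENNReal.ofReal C := by
          refine liminf_le_of_le (by isBoundedDefault) fun b hb => ?_
          obtain ⟨n, hn⟩ := hb.exists
          refine hn.trans ?_
          rw [← ofReal_integral_eq_lintegral_ofReal (hi (by fun_prop)) (hμ.mono (hS0 n))]
          exact ENNReal.ofReal_le_ofReal (hC n)
  refine ⟨h0, hint, tendsto_integral_of_dominated_convergence (fun t => 1 / t)
    (fun n => Continuous.aestronglyMeasurable (by fun_prop)) hint (fun n => ?_) hlim⟩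
  filter_upwards [hμ, h0] with t ht ht0
  have := geom_sum_one_sub_le ht ht0 (2 * n)
  rw [Real.norm_of_nonneg this.1]
  exact this.2

/-! ### Alternating binomial sums of powers and of moments. -/

theorem sum_altCoeff_mul_pow (m : ℕ) (t : ℝ) :
    ∑ i ∈ Finset.range (m + 1), altCoeff m i * t ^ i = (1 - t) ^ m := by
  rw [sub_eq_neg_add, add_pow]
  refine Finset.sum_congr rfl fun i _ => ?_
  rw [altCoeff, neg_pow t]
  ring

/-- Both sides are `((1-t)^m - 1)/t`. This shifted sum arises because column moments are `y₀²` times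
those of `η₁`, one index lower. -/
theorem sum_altCoeff_succ_mul_pow (m : ℕ) (t : ℝ) :
    ∑ i ∈ Finset.range m, altCoeff m (i + 1) * t ^ i = -∑ l ∈ Finset.range m, (1 - t) ^ l := by
  rcases eq_or_ne t 0 with rfl | ht
  · cases m with
    | zero => simp
    | succ m => rw [Finset.sum_range_succ']; simp [altCoeff]
  · apply mul_right_cancel₀ ht
    have h1 := sum_altCoeff_mul_pow m t
    have h2 := geom_sum_mul_neg (1 - t) m
    rw [Finset.sum_range_succ'] at h1
    rw [sub_sub_cancel] at h2
    rw [neg_mul, h2, Finset.sum_mul, ← h1]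
    simp [altCoeff, pow_succ, mul_assoc]

theorem altCoeff_zero (m : ℕ) : altCoeff m 0 = 1 := by simp [altCoeff]

theorem sum_altCoeff {m : ℕ} (hm : m ≠ 0) : ∑ i ∈ Finset.range (m + 1), altCoeff m i = 0 := by
  have := sum_altCoeff_mul_pow m 1
  simpa [hm] using this

theorem sum_altCoeff_mul_integral_pow (hμ : ∀ᵐ t ∂μ, t ∈ Set.Icc (0 : ℝ) 1) (m : ℕ) :
    ∑ i ∈ Finset.range (m + 1), altCoeff m i * ∫ t, t ^ i ∂μ = ∫ t, (1 - t) ^ m ∂μ := by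
  simp_rw [← sum_altCoeff_mul_pow]
  rw [integral_finsetSum]
  · simp_rw [integral_const_mul]
  · exact fun i _ => integrable_of_continuous_of_ae_mem_Icc hμ (by fun_prop)

theorem sum_altCoeff_succ_mul_integral_pow (hμ : ∀ᵐ t ∂μ, t ∈ Set.Icc (0 : ℝ) 1) (m : ℕ) :
    ∑ i ∈ Finset.range m, altCoeff m (i + 1) * ∫ t, t ^ i ∂μ =
      -∫ t, ∑ l ∈ Finset.range m, (1 - t) ^ l ∂μ := by
  rw [← integral_neg]
  simp_rw [← sum_altCoeff_succ_mul_pow]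
  rw [integral_finsetSum]
  · simp_rw [integral_const_mul]
  · exact fun i _ => integrable_of_continuous_of_ae_mem_Icc hμ (by fun_prop)

end UnitInterval

/-! ## The weight diagram and its moments -/

theorem abs_le_norm_weightedShift {κ : Type*} (φ : κ ↪ κ) (w : κ → ℝ) (hw : ∃ C, ∀ k, |w k| ≤ C)
    (k : κ) : |w k| ≤ ‖weightedShift φ w hw‖ := by
  classical
  have h := (weightedShift φ w hw).le_opNorm (lp.single 2 k (1 : ℂ))
  rw [weightedShift_single, norm_smul, lp.norm_single (by norm_num), lp.norm_single (by norm_num),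
    norm_one, mul_one, mul_one, Complex.norm_real, Real.norm_eq_abs] at h
  exact h

theorem shiftMoment_pos {w : ℕ → ℝ} (hw : ∀ n, 0 < w n) (k : ℕ) : 0 < shiftMoment w k :=
  Finset.prod_pos fun i _ => pow_pos (hw i) 2

theorem shiftMoment_succ (w : ℕ → ℝ) (k : ℕ) :
    shiftMoment w (k + 1) = shiftMoment w k * w k ^ 2 :=
  Finset.prod_range_succ _ _

theorem shiftMoment_succ' (w : ℕ → ℝ) (k : ℕ) :
    shiftMoment w (k + 1) = w 0 ^ 2 * shiftMoment (fun n => w (n + 1)) k := by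
  rw [shiftMoment, Finset.prod_range_succ', mul_comm]
  rfl

theorem shiftMoment_zero (w : ℕ → ℝ) : shiftMoment w 0 = 1 := rfl

/-- A weight diagram together with Berger measures on `[0, 1]` of its `0`-th row and of its
truncated `0`-th column, whose atoms at `1` are large enough for contractivity. -/
structure DiagramData (x y : ℕ → ℝ) (a : ℝ) (W : ShiftWeights) (ξ η₁ : Measure ℝ) : Prop where
  alpha : W.α = diagramAlpha x y a
  beta : W.β = diagramBeta x y a
  x_pos : ∀ n, 0 < x n
  y_pos : ∀ n, 0 < y n
  a_pos : 0 < a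
  prob_ξ : IsProbabilityMeasure ξ
  prob_η₁ : IsProbabilityMeasure η₁
  supp_ξ : ∀ᵐ t ∂ξ, t ∈ Set.Icc (0 : ℝ) 1
  supp_η₁ : ∀ᵐ t ∂η₁, t ∈ Set.Icc (0 : ℝ) 1
  moment_ξ : ∀ k : ℕ, ∫ t, t ^ k ∂ξ = shiftMoment x k
  moment_η₁ : ∀ k : ℕ, ∫ t, t ^ k ∂η₁ = shiftMoment (fun n => y (n + 1)) k
  atom_ξ : (a * y 0) ^ 2 ≤ ξ.real {1}
  atom_η₁ : a ^ 2 ≤ η₁.real {1}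

theorem IsBergerMeasure.ae_mem_Icc {w : ℕ → ℝ} {μ : Measure ℝ} (h : IsBergerMeasure w μ)
    (h0 : ∀ n, 0 < w n) (h1 : ∀ n, w n ≤ 1) : ∀ᵐ t ∂μ, t ∈ Set.Icc (0 : ℝ) 1 := by
  have hs : ∀ᵐ t ∂μ, t ∈ Set.Icc (0 : ℝ) ((⨆ n, w n) ^ 2) := h.support
  have hle : (⨆ n, w n) ^ 2 ≤ 1 :=
    pow_le_one₀ (Real.iSup_nonneg fun n => (h0 n).le) (ciSup_le h1)
  exact hs.mono fun t ht => ⟨ht.1, ht.2.trans hle⟩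

-- Contractivity gives the atoms: `β_{(n+1,0)} ≤ 1` says `(a y₀)² ≤ γ_{n+1}(x)`, and moments on
-- `[0,1]` tend to the mass at `1`. The column works likewise with `α_{(0,n+1)} ≤ 1`.
open Filter Topology in
theorem DiagramData.of_isSFC {x y : ℕ → ℝ} {a : ℝ} {W : ShiftWeights} {ξ η₁ : Measure ℝ}
    (hα : W.α = diagramAlpha x y a) (hβ : W.β = diagramBeta x y a) (hW : W.IsSFC)
    (hξ : IsBergerMeasure x ξ) (hη₁ : IsBergerMeasure (fun n => y (n + 1)) η₁) :
    DiagramData x y a W ξ η₁ := by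
  have hα1 : ∀ k, W.α k ≤ 1 := fun k => (le_abs_self _).trans
    ((abs_le_norm_weightedShift _ _ W.α_bdd k).trans hW.contractive₁)
  have hβ1 : ∀ k, W.β k ≤ 1 := fun k => (le_abs_self _).trans
    ((abs_le_norm_weightedShift _ _ W.β_bdd k).trans hW.contractive₂)
  have hx : ∀ n, 0 < x n := fun n => by
    have := W.α_pos (n, 0); rw [hα] at this; simpa [diagramAlpha] using this
  have hx1 : ∀ n, x n ≤ 1 := fun n => by
    have := hα1 (n, 0); rw [hα] at this; simpa [diagramAlpha] using this
  have hy : ∀ n, 0 < y n := fun n => by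
    have := W.β_pos (0, n); rw [hβ] at this; simpa [diagramBeta] using this
  have hy1 : ∀ n, y n ≤ 1 := fun n => by
    have := hβ1 (0, n); rw [hβ] at this; simpa [diagramBeta] using this
  have ha : 0 < a := by
    have := W.α_pos (0, 1); rw [hα] at this; simpa [diagramAlpha, shiftMoment] using this
  have sξ := hξ.ae_mem_Icc hx hx1
  have sη := hη₁.ae_mem_Icc (fun n => hy _) (fun n => hy1 _)
  have pξ := hξ.isProbabilityMeasure
  have pη := hη₁.isProbabilityMeasure
  refine ⟨hα, hβ, hx, hy, ha, pξ, pη, sξ, sη, hξ.moment, hη₁.moment, ?_, ?_⟩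
  · refine ge_of_tendsto ((tendsto_integral_pow sξ).comp (tendsto_add_atTop_nat 1))
      (Eventually.of_forall fun n => ?_)
    have h := hβ1 (n + 1, 0)
    rw [hβ] at h
    simp only [diagramBeta] at h
    rw [div_le_one (Real.sqrt_pos.2 (shiftMoment_pos hx _)),
      Real.le_sqrt' (mul_pos ha (hy 0))] at h
    rw [Function.comp_apply, hξ.moment]
    exact h
  · refine ge_of_tendsto (tendsto_integral_pow sη) (Eventually.of_forall fun n => ?_)
    have h := hα1 (0, n + 1)
    rw [hα] at h
    simp only [diagramAlpha] at h
    rw [div_le_one (Real.sqrt_pos.2 (shiftMoment_pos (fun n => hy _) _)), Real.le_sqrt' ha] at h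
    rw [hη₁.moment]
    exact h

namespace DiagramData

variable {x y : ℕ → ℝ} {a : ℝ} {W : ShiftWeights} {ξ η₁ : Measure ℝ}

theorem moment_zero_right (h : DiagramData x y a W ξ η₁) (i : ℕ) :
    W.moment i 0 = shiftMoment x i := by
  simp [ShiftWeights.moment, h.alpha, diagramAlpha, shiftMoment]

theorem moment_zero_left (h : DiagramData x y a W ξ η₁) (j : ℕ) :
    W.moment 0 j = shiftMoment y j := by
  simp [ShiftWeights.moment, h.beta, diagramBeta, shiftMoment]

/-- The factor `a² / γ_j(y₁, …)` of the first horizontal step cancels `γ_{j+1}(y) = y₀² γ_j(y₁, …)`;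
all later steps have weight `1`. -/
theorem moment_succ_succ (h : DiagramData x y a W ξ η₁) (i j : ℕ) :
    W.moment (i + 1) (j + 1) = (a * y 0) ^ 2 := by
  have e : W.moment (i + 1) (j + 1) = shiftMoment y (j + 1) *
      ∏ l ∈ Finset.range (i + 1), diagramAlpha x y a (l, j + 1) ^ 2 := by
    simp [ShiftWeights.moment, h.alpha, h.beta, diagramBeta, shiftMoment]
  have hp := shiftMoment_pos (fun n => h.y_pos (n + 1)) j
  rw [e, Finset.prod_range_succ', shiftMoment_succ']
  simp only [diagramAlpha, one_pow, Finset.prod_const_one, one_mul, div_pow]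
  rw [Real.sq_sqrt hp.le]
  field_simp

theorem moment_pos (W : ShiftWeights) (i j : ℕ) : 0 < W.moment i j :=
  mul_pos (Finset.prod_pos fun _ _ => pow_pos (W.β_pos _) 2)
    (Finset.prod_pos fun _ _ => pow_pos (W.α_pos _) 2)

theorem moment_add_left (W : ShiftWeights) (i j : ℕ) :
    W.moment (i + 1) j = W.α (i, j) ^ 2 * W.moment i j := by
  rw [ShiftWeights.moment, ShiftWeights.moment, Finset.prod_range_succ]
  ring

/-- Path independence: `moment` goes up first, so only the vertical recursion depends on the shape
of the diagram. -/
theorem moment_add_right (h : DiagramData x y a W ξ η₁) (i j : ℕ) :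
    W.moment i (j + 1) = W.β (i, j) ^ 2 * W.moment i j := by
  cases i with
  | zero =>
    rw [h.moment_zero_left, h.moment_zero_left, shiftMoment_succ, h.beta]
    simp only [diagramBeta]
    ring
  | succ i =>
    cases j with
    | zero =>
      have hp := shiftMoment_pos h.x_pos (i + 1)
      rw [h.moment_succ_succ, h.moment_zero_right, h.beta]
      simp only [diagramBeta]
      rw [div_pow, Real.sq_sqrt hp.le]
      field_simp
    | succ j =>
      rw [h.moment_succ_succ, h.moment_succ_succ, h.beta]
      simp [diagramBeta]

/-- Alternating sums of the moments of the `0`-th column. -/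
theorem sum_altCoeff_moment_zero_left (h : DiagramData x y a W ξ η₁) (m : ℕ) :
    ∑ j ∈ Finset.range (m + 1), altCoeff m j * W.moment 0 j =
      1 - y 0 ^ 2 * ∫ t, ∑ l ∈ Finset.range m, (1 - t) ^ l ∂η₁ := by
  have := h.prob_η₁
  rw [Finset.sum_range_succ', altCoeff_zero, h.moment_zero_left, shiftMoment_zero]
  simp_rw [h.moment_zero_left, shiftMoment_succ', ← h.moment_η₁]
  rw [sub_eq_neg_add, ← mul_neg, ← sum_altCoeff_succ_mul_integral_pow h.supp_η₁, Finset.mul_sum]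
  simp only [mul_one, mul_left_comm]

open Filter Topology in
theorem integrable_one_div (h : DiagramData x y a W ξ η₁) (hsub : IsSubnormalOperator W.T₂) :
    (∀ᵐ t ∂η₁, t ≠ 0) ∧ Integrable (fun t => 1 / t) η₁ ∧
      Tendsto (fun n : ℕ => ∫ t, ∑ l ∈ Finset.range (2 * n), (1 - t) ^ l ∂η₁) atTop
        (𝓝 (∫ t, 1 / t ∂η₁)) := by
  have := h.prob_η₁
  refine integrable_one_div_of_integral_geom_sum_le h.supp_η₁ (1 / y 0 ^ 2) fun n => ?_
  have h1 := W.sum_altCoeff_moment_zero_nonneg hsub n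
  rw [h.sum_altCoeff_moment_zero_left] at h1
  rw [le_div_iff₀ (pow_pos (h.y_pos 0) 2)]
  linarith

/-- Since the coefficients sum to `0`, those of positive index sum to `-1`, and the constant
interior moments contribute `(-1)² (a y₀)²`. The rest comes from the two axes. -/
theorem sum_altCoeff_moment (h : DiagramData x y a W ξ η₁) {m : ℕ} (hm : m ≠ 0) :
    ∑ i ∈ Finset.range (m + 1), ∑ j ∈ Finset.range (m + 1),
      altCoeff m i * altCoeff m j * W.moment i j =
    (a * y 0) ^ 2 + ∫ t, (1 - t) ^ m ∂ξ -
      y 0 ^ 2 * ∫ t, ∑ l ∈ Finset.range m, (1 - t) ^ l ∂η₁ := by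
  have := h.prob_ξ
  have h0 := sum_altCoeff hm
  rw [Finset.sum_range_succ', altCoeff_zero] at h0
  have hξ := sum_altCoeff_mul_integral_pow h.supp_ξ m
  rw [Finset.sum_range_succ', altCoeff_zero] at hξ
  simp_rw [h.moment_ξ, shiftMoment_zero] at hξ
  have hη := h.sum_altCoeff_moment_zero_left m
  rw [Finset.sum_range_succ']
  simp only [altCoeff_zero, one_mul]
  rw [hη]
  have hinner : ∀ i, ∑ j ∈ Finset.range (m + 1), altCoeff m (i + 1) * altCoeff m j *
      W.moment (i + 1) j =
      altCoeff m (i + 1) * shiftMoment x (i + 1) - (a * y 0) ^ 2 * altCoeff m (i + 1) := by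
    intro i
    rw [Finset.sum_range_succ', h.moment_zero_right, altCoeff_zero]
    simp_rw [h.moment_succ_succ]
    rw [← Finset.sum_mul, ← Finset.mul_sum, eq_neg_of_add_eq_zero_left h0]
    ring
  simp_rw [hinner]
  rw [Finset.sum_sub_distrib, ← Finset.mul_sum, eq_neg_of_add_eq_zero_left h0]
  linarith

-- The nonnegative alternating sums tend to `(a y₀)² + ξ{0} - y₀² ∫ 1/t dη₁`, the mass left for the
-- origin.
open Filter Topology in
theorem le_of_isJointlySubnormal (h : DiagramData x y a W ξ η₁)
    (hsub : IsSubnormalOperator W.T₂) (hW : IsJointlySubnormal W.pair) :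
    y 0 ^ 2 * (∫ t, 1 / t ∂η₁ - a ^ 2) ≤ ξ.real {0} := by
  have := h.prob_ξ
  have l1 : Tendsto (fun n : ℕ => ∫ t, (1 - t) ^ (2 * n) ∂ξ) atTop (𝓝 (ξ.real {0})) :=
    (tendsto_integral_one_sub_pow h.supp_ξ).comp (tendsto_id.const_mul_atTop' (by norm_num))
  have l2 := ((tendsto_const_nhds (x := (a * y 0) ^ 2)).add l1).sub
    ((h.integrable_one_div hsub).2.2.const_mul (y 0 ^ 2))
  have := ge_of_tendsto (b := 0) l2 (by
    filter_upwards [eventually_ne_atTop 0] with n hn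
    rw [← h.sum_altCoeff_moment (mul_ne_zero two_ne_zero hn)]
    exact W.sum_altCoeff_moment_nonneg hW n)
  linarith

end DiagramData

/-! ## Construction of the Berger measure of the pair -/

theorem exists_measure_density {μ : Measure ℝ} (hμ : ∀ᵐ t ∂μ, t ∈ Set.Icc (0 : ℝ) 1) {d : ℝ → ℝ}
    (hd : Measurable d) (hd0 : ∀ᵐ t ∂μ, 0 ≤ d t) (hdi : Integrable d μ) :
    ∃ ν : Measure ℝ, IsFiniteMeasure ν ∧ (∀ᵐ t ∂ν, t ∈ Set.Icc (0 : ℝ) 1) ∧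
      ∀ g : ℝ → ℝ, ∫ t, g t ∂ν = ∫ t, d t * g t ∂μ := by
  refine ⟨μ.withDensity fun t => ENNReal.ofReal (d t), isFiniteMeasure_withDensity_ofReal hdi.2,
    withDensity_absolutelyContinuous μ _ |>.ae_le hμ, fun g => ?_⟩
  rw [integral_withDensity_eq_integral_toReal_smul (by fun_prop)
    (ae_of_all _ fun _ => ENNReal.ofReal_lt_top)]
  refine integral_congr_ae (hd0.mono fun t ht => ?_)
  simp [ENNReal.toReal_ofReal ht]

/-- Two measures on the axes of the unit square, and two atoms at its corners. -/
theorem exists_measure_axes (ν₁ ν₂ : Measure ℝ) [IsFiniteMeasure ν₁] [IsFiniteMeasure ν₂]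
    (h₁ : ∀ᵐ t ∂ν₁, t ∈ Set.Icc (0 : ℝ) 1) (h₂ : ∀ᵐ t ∂ν₂, t ∈ Set.Icc (0 : ℝ) 1)
    {c A : ℝ} (hc : 0 ≤ c) (hA : 0 ≤ A) :
    ∃ μ : Measure (ℝ × ℝ), IsFiniteMeasure μ ∧
      (∀ᵐ z ∂μ, z.1 ∈ Set.Icc (0 : ℝ) 1 ∧ z.2 ∈ Set.Icc (0 : ℝ) 1) ∧
      ∀ f : ℝ × ℝ → ℝ, Continuous f → ∫ z, f z ∂μ =
        ∫ s, f (s, 0) ∂ν₁ + ∫ t, f (0, t) ∂ν₂ + c * f (0, 0) + A * f (1, 1) := by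
  have m₁ : Measurable fun s : ℝ => (s, (0 : ℝ)) := by fun_prop
  have m₂ : Measurable fun t : ℝ => ((0 : ℝ), t) := by fun_prop
  have hS : MeasurableSet
      {z : ℝ × ℝ | z.1 ∈ Set.Icc (0 : ℝ) 1 ∧ z.2 ∈ Set.Icc (0 : ℝ) 1} :=
    (measurable_fst measurableSet_Icc).inter (measurable_snd measurableSet_Icc)
  have a₁ : ∀ᵐ z ∂(ν₁.map fun s => (s, (0 : ℝ))),
      z.1 ∈ Set.Icc (0 : ℝ) 1 ∧ z.2 ∈ Set.Icc (0 : ℝ) 1 := by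
    rw [ae_map_iff m₁.aemeasurable hS]
    exact h₁.mono fun t ht => ⟨ht, by simp⟩
  have a₂ : ∀ᵐ z ∂(ν₂.map fun t => ((0 : ℝ), t)),
      z.1 ∈ Set.Icc (0 : ℝ) 1 ∧ z.2 ∈ Set.Icc (0 : ℝ) 1 := by
    rw [ae_map_iff m₂.aemeasurable hS]
    exact h₂.mono fun t ht => ⟨by simp, ht⟩
  have hcpt : IsCompact (Set.Icc (0 : ℝ) 1 ×ˢ Set.Icc (0 : ℝ) 1) := isCompact_Icc.prod isCompact_Icc
  refine ⟨ν₁.map (fun s => (s, (0 : ℝ))) + ν₂.map (fun t => ((0 : ℝ), t)) +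
    ENNReal.ofReal c • Measure.dirac (0, 0) + ENNReal.ofReal A • Measure.dirac (1, 1), ?_, ?_, ?_⟩
  · have e₁ := Measure.smul_finite (Measure.dirac ((0 : ℝ), (0 : ℝ))) (ENNReal.ofReal_ne_top (r := c))
    have e₂ := Measure.smul_finite (Measure.dirac ((1 : ℝ), (1 : ℝ))) (ENNReal.ofReal_ne_top (r := A))
    infer_instance
  · rw [ae_add_measure_iff, ae_add_measure_iff, ae_add_measure_iff]
    refine ⟨⟨⟨a₁, a₂⟩, Measure.ae_smul_measure ?_ _⟩, Measure.ae_smul_measure ?_ _⟩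
    · rw [ae_dirac_iff hS]; simp
    · rw [ae_dirac_iff hS]; simp
  · intro f hf
    obtain ⟨C, hC⟩ := hcpt.exists_bound_of_continuousOn hf.continuousOn
    have i₁ : Integrable f (ν₁.map fun s => (s, (0 : ℝ))) :=
      Integrable.of_bound hf.aestronglyMeasurable C (a₁.mono fun z hz => hC z hz)
    have i₂ : Integrable f (ν₂.map fun t => ((0 : ℝ), t)) :=
      Integrable.of_bound hf.aestronglyMeasurable C (a₂.mono fun z hz => hC z hz)
    have i₃ : ∀ (b : ℝ) (z : ℝ × ℝ), Integrable f (ENNReal.ofReal b • Measure.dirac z) :=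
      fun b z => (integrable_dirac (by simp)).smul_measure ENNReal.ofReal_ne_top
    rw [integral_add_measure ((i₁.add_measure i₂).add_measure (i₃ _ _)) (i₃ _ _),
      integral_add_measure (i₁.add_measure i₂) (i₃ _ _), integral_add_measure i₁ i₂,
      integral_smul_measure, integral_smul_measure, integral_dirac, integral_dirac,
      integral_map m₁.aemeasurable hf.aestronglyMeasurable,
      integral_map m₂.aemeasurable hf.aestronglyMeasurable, ENNReal.toReal_ofReal hc,
      ENNReal.toReal_ofReal hA, smul_eq_mul, smul_eq_mul]

namespace DiagramData

variable {x y : ℕ → ℝ} {a : ℝ} {W : ShiftWeights} {ξ η₁ : Measure ℝ}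

/-- The part of `ξ` carried by the horizontal axis. -/
theorem exists_measure_horizontal (h : DiagramData x y a W ξ η₁) :
    ∃ ν : Measure ℝ, IsFiniteMeasure ν ∧ (∀ᵐ t ∂ν, t ∈ Set.Icc (0 : ℝ) 1) ∧
      ∀ i : ℕ, ∫ t, t ^ i ∂ν = shiftMoment x i - (a * y 0) ^ 2 - 0 ^ i * ξ.real {0} := by
  have := h.prob_ξ
  have hA : 0 < (a * y 0) ^ 2 := pow_pos (mul_pos h.a_pos (h.y_pos 0)) 2
  have hq : 0 < ξ.real {1} := hA.trans_le h.atom_ξ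
  -- The fraction of the atom at `1` to be removed, so that density `1 - c·1_{1} - 1_{0}` gives `ξ -
  -- (a y₀)² δ₁ - ξ{0} δ₀`. The atom bound is `c ≤ 1`.
  set c := (a * y 0) ^ 2 / ξ.real {1} with hc
  have hc1 : c ≤ 1 := (div_le_one hq).2 h.atom_ξ
  let d : ℝ → ℝ := fun t => 1 - c * (if t = 1 then 1 else 0) - if t = 0 then 1 else 0
  have hi : ∀ b : ℝ, Integrable (fun t => if t = b then (1 : ℝ) else 0) ξ := integrable_ite_eq
  have hm : ∀ b : ℝ, Measurable (fun t => if t = b then (1 : ℝ) else 0) := fun b =>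
    Measurable.ite (measurableSet_singleton b) measurable_const measurable_const
  obtain ⟨ν, hν, hν1, hν2⟩ := exists_measure_density h.supp_ξ (d := d)
    ((measurable_const.sub ((hm 1).const_mul c)).sub (hm 0))
    (ae_of_all _ fun t => by
      simp only [d]
      split_ifs with h1 h2
      · linarith
      · linarith
      · linarith
      · linarith)
    (((integrable_const 1).sub ((hi 1).const_mul c)).sub (hi 0))
  refine ⟨ν, hν, hν1, fun i => ?_⟩
  have e : ∀ t : ℝ, d t * t ^ i = t ^ i - c * (if t = 1 then 1 else 0) -
      0 ^ i * (if t = 0 then 1 else 0) := by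
    intro t
    simp only [d]
    split_ifs with h1 h2 h2
    · linarith
    · simp [h1]
    · simp [h2]
    · ring
  have hp : Integrable (fun t : ℝ => t ^ i) ξ :=
    integrable_of_continuous_of_ae_mem_Icc h.supp_ξ (by fun_prop)
  simp_rw [hν2, e]
  have hpc : Integrable (fun t : ℝ => t ^ i - c * if t = 1 then 1 else 0) ξ :=
    hp.sub ((hi 1).const_mul c)
  rw [integral_sub hpc ((hi 0).const_mul _),
    integral_sub hp ((hi 1).const_mul c), integral_const_mul, integral_const_mul,
    integral_ite_eq_measureReal, integral_ite_eq_measureReal, h.moment_ξ, hc,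
    div_mul_cancel₀ _ hq.ne']

/-- The part of the Berger measure of the `0`-th column carried by the vertical axis. -/
theorem exists_measure_vertical (h : DiagramData x y a W ξ η₁) (h0 : ∀ᵐ t ∂η₁, t ≠ 0)
    (hint : Integrable (fun t => 1 / t) η₁) :
    ∃ ν : Measure ℝ, IsFiniteMeasure ν ∧ (∀ᵐ t ∂ν, t ∈ Set.Icc (0 : ℝ) 1) ∧
      ∫ t, t ^ 0 ∂ν = y 0 ^ 2 * (∫ t, 1 / t ∂η₁ - a ^ 2) ∧
      ∀ j : ℕ, ∫ t, t ^ (j + 1) ∂ν = shiftMoment y (j + 1) - (a * y 0) ^ 2 := by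
  have := h.prob_η₁
  have hq : 0 < η₁.real {1} := (pow_pos h.a_pos 2).trans_le h.atom_η₁
  -- Chosen so that the density below gives `y₀² (dη₁/t - a² δ₁)`; at `t = 1` positivity is `c ≤ 1`.
  set c := a ^ 2 / η₁.real {1} with hc
  have hc1 : c ≤ 1 := (div_le_one hq).2 h.atom_η₁
  let d : ℝ → ℝ := fun t => y 0 ^ 2 * (1 / t - c * if t = 1 then 1 else 0)
  have hi : Integrable (fun t => if t = 1 then (1 : ℝ) else 0) η₁ := integrable_ite_eq 1
  have hm : Measurable (fun t : ℝ => if t = 1 then (1 : ℝ) else 0) :=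
    Measurable.ite (measurableSet_singleton 1) measurable_const measurable_const
  obtain ⟨ν, hν, hν1, hν2⟩ := exists_measure_density h.supp_η₁ (d := d)
    (((measurable_const.div measurable_id).sub (hm.const_mul c)).const_mul _)
    (h.supp_η₁.mono fun t ht => by
      simp only [d]
      refine mul_nonneg (sq_nonneg _) ?_
      split_ifs with h1
      · rw [h1]; linarith
      · have := one_div_nonneg.2 ht.1; linarith)
    ((hint.sub (hi.const_mul c)).const_mul _)
  have key : ∀ (j : ℕ) (g : ℝ → ℝ), Integrable g η₁ → (∀ᵐ t ∂η₁, 1 / t * t ^ j = g t) →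
      ∫ t, t ^ j ∂ν = y 0 ^ 2 * (∫ t, g t ∂η₁ - a ^ 2) := by
    intro j g hg hgj
    have e : ∀ᵐ t ∂η₁, d t * t ^ j = y 0 ^ 2 * (g t - c * if t = 1 then 1 else 0) := by
      filter_upwards [hgj] with t ht
      rw [← ht]
      simp only [d]
      split_ifs with h1
      · simp [h1]
      · ring
    rw [hν2, integral_congr_ae e, integral_const_mul, integral_sub hg (hi.const_mul c),
      integral_const_mul, integral_ite_eq_measureReal, hc, div_mul_cancel₀ _ hq.ne']
  refine ⟨ν, hν, hν1, key 0 _ hint (ae_of_all _ fun t => by simp), fun j => ?_⟩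
  rw [key (j + 1) (fun t => t ^ j)
    (integrable_of_continuous_of_ae_mem_Icc h.supp_η₁ (by fun_prop))
    (h0.mono fun t ht => by rw [pow_succ]; field_simp), h.moment_η₁, shiftMoment_succ']
  ring

theorem isJointlySubnormal_of_le (h : DiagramData x y a W ξ η₁) (h0 : ∀ᵐ t ∂η₁, t ≠ 0)
    (hint : Integrable (fun t => 1 / t) η₁)
    (hle : y 0 ^ 2 * (∫ t, 1 / t ∂η₁ - a ^ 2) ≤ ξ.real {0}) : IsJointlySubnormal W.pair := by
  obtain ⟨ν₁, _, hν₁, m₁⟩ := h.exists_measure_horizontal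
  obtain ⟨ν₂, _, hν₂, m₂, m₂'⟩ := h.exists_measure_vertical h0 hint
  obtain ⟨μ, hμ, hμ1, hμ2⟩ := exists_measure_axes ν₁ ν₂ hν₁ hν₂ (sub_nonneg.2 hle)
    (sq_nonneg (a * y 0))
  refine W.isJointlySubnormal_of_measure μ hμ1 (fun k => W.moment k.1 k.2)
    (fun k => moment_pos W _ _) (fun k => moment_add_left W _ _)
    (fun k => h.moment_add_right _ _) ?_
  rintro ⟨i, j⟩
  simp only
  rw [hμ2 (fun z => z.1 ^ i * z.2 ^ j) (by fun_prop)]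
  simp only [integral_mul_const, integral_const_mul]
  rw [m₁]
  cases j with
  | zero =>
    rw [m₂, h.moment_zero_right]
    cases i with
    | zero => simp only [pow_zero, shiftMoment_zero]; ring
    | succ i => simp
  | succ j =>
    rw [m₂']
    cases i with
    | zero => rw [h.moment_zero_left]; simp
    | succ i => rw [h.moment_succ_succ]; simp

theorem isJointlySubnormal_iff (h : DiagramData x y a W ξ η₁)
    (hsub : IsSubnormalOperator W.T₂) :
    IsJointlySubnormal W.pair ↔ y 0 ^ 2 * (∫ t, 1 / t ∂η₁ - a ^ 2) ≤ ξ.real {0} :=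
  ⟨h.le_of_isJointlySubnormal hsub, h.isJointlySubnormal_of_le (h.integrable_one_div hsub).1
    (h.integrable_one_div hsub).2.1⟩

end DiagramData

/-! ## Joint hyponormality -/

/-- The quadratic form of the commutator matrix at `(f, g)`: its negative terms assemble into a
single square `‖S*f + T*g‖²`. -/
theorem isJointlyHyponormal_iff {H : Type*} [NormedAddCommGroup H] [InnerProductSpace ℂ H]
    [CompleteSpace H] (S T : H →L[ℂ] H) (hST : Commute S T) :
    IsJointlyHyponormal ![S, T] ↔ ∀ f g : H,
      ‖ContinuousLinearMap.adjoint S f + ContinuousLinearMap.adjoint T g‖ ^ 2 ≤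
        ‖S f‖ ^ 2 + ‖T g‖ ^ 2 + 2 * (inner ℂ (S g) (T f)).re := by
  have hc : ∀ i j, Commute (![S, T] i) (![S, T] j) := by
    intro i j
    fin_cases i <;> fin_cases j
    exacts [Commute.refl _, hST, hST.symm, Commute.refl _]
  have key : ∀ F : PiLp 2 (fun _ : Fin 2 => H),
      inner ℂ (operatorMatrix (fun i j =>
        ContinuousLinearMap.adjoint (![S, T] j) ∘L ![S, T] i -
          ![S, T] i ∘L ContinuousLinearMap.adjoint (![S, T] j)) F) F =
      ((‖S (F 0)‖ ^ 2 + ‖T (F 1)‖ ^ 2 + 2 * (inner ℂ (S (F 1)) (T (F 0))).re -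
        ‖ContinuousLinearMap.adjoint S (F 0) + ContinuousLinearMap.adjoint T (F 1)‖ ^ 2 : ℝ) :
          ℂ) := by
    intro F
    have hn : ∀ v : H, ((‖v‖ : ℂ)) ^ 2 = inner ℂ v v := fun v => by
      rw [inner_self_eq_norm_sq_to_K]; rfl
    have hre : (((2 * (inner ℂ (S (F 1)) (T (F 0))).re : ℝ)) : ℂ) =
        inner ℂ (S (F 1)) (T (F 0)) + inner ℂ (T (F 0)) (S (F 1)) := by
      rw [← inner_conj_symm (T (F 0)) (S (F 1)), Complex.add_conj]
    rw [Complex.ofReal_sub, Complex.ofReal_add, Complex.ofReal_add, hre]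
    push_cast
    rw [hn, hn, hn, PiLp.inner_apply]
    simp only [operatorMatrix_apply, Fin.sum_univ_two, Matrix.cons_val_zero, Matrix.cons_val_one,
      map_add, inner_add_left, inner_add_right, inner_sub_left, ContinuousLinearMap.comp_apply,
      sub_apply, ContinuousLinearMap.adjoint_inner_left,
      ContinuousLinearMap.adjoint_inner_right]
    ring
  rw [IsJointlyHyponormal, ContinuousLinearMap.isPositive_iff_complex]
  refine ⟨fun h f g => ?_, fun h => ⟨hc, fun F => ?_⟩⟩
  · have := (h.2 (WithLp.toLp 2 ![f, g])).2
    rw [key] at this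
    simp only [Matrix.cons_val_zero, Matrix.cons_val_one] at this
    have h' : ∀ r : ℝ, RCLike.re (r : ℂ) = r := Complex.ofReal_re
    rw [h'] at this
    linarith
  · rw [key]
    have h' : ∀ r : ℝ, RCLike.re (r : ℂ) = r := Complex.ofReal_re
    rw [h']
    exact ⟨rfl, by linarith [h (F 0) (F 1)]⟩

theorem adjoint_weightedShift_apply {κ : Type*} (φ : κ ↪ κ) (w : κ → ℝ)
    (hw : ∃ C, ∀ k, |w k| ≤ C) (f : lp (fun _ : κ => ℂ) 2) (k : κ) :
    ContinuousLinearMap.adjoint (weightedShift φ w hw) f k = (w k : ℂ) * f (φ k) := by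
  classical
  have h := lp.inner_single_left (𝕜 := ℂ) k (1 : ℂ)
    (ContinuousLinearMap.adjoint (weightedShift φ w hw) f)
  rw [ContinuousLinearMap.adjoint_inner_right, weightedShift_single, inner_smul_left,
    lp.inner_single_left] at h
  simpa using h.symm

theorem adjoint_weightedShift_single {κ : Type*} [DecidableEq κ] (φ : κ ↪ κ) (w : κ → ℝ)
    (hw : ∃ C, ∀ k, |w k| ≤ C) (k : κ) :
    ContinuousLinearMap.adjoint (weightedShift φ w hw) (lp.single 2 (φ k) (1 : ℂ)) =
      (w k : ℂ) • lp.single 2 k (1 : ℂ) := by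
  ext l
  rw [adjoint_weightedShift_apply, lp.coeFn_smul, Pi.smul_apply, lp.single_apply,
    lp.single_apply, smul_eq_mul]
  rcases eq_or_ne l k with rfl | hl
  · simp
  · have hl' : φ l ≠ φ k := fun e => hl (φ.injective e)
    simp [Pi.single_eq_of_ne hl, Pi.single_eq_of_ne hl']

theorem hasSum_norm_sq {κ : Type*} (f : lp (fun _ : κ => ℂ) 2) :
    HasSum (fun k => ‖f k‖ ^ 2) (‖f‖ ^ 2) := by
  have := lp.hasSum_norm (p := 2) (by norm_num) f
  simpa using this

theorem summable_and_tsum_norm_weightedShift_sq_le {κ : Type*} (φ ψ : κ ↪ κ) (w : κ → ℝ)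
    (hw : ∃ C, ∀ k, |w k| ≤ C) (f : lp (fun _ : κ => ℂ) 2) :
    Summable (fun k => w (ψ k) ^ 2 * ‖f (ψ k)‖ ^ 2) ∧
      ∑' k, w (ψ k) ^ 2 * ‖f (ψ k)‖ ^ 2 ≤ ‖weightedShift φ w hw f‖ ^ 2 := by
  have h := hasSum_norm_sq (weightedShift φ w hw f)
  have e : (fun k => w (ψ k) ^ 2 * ‖f (ψ k)‖ ^ 2) =
      (fun k => ‖weightedShift φ w hw f k‖ ^ 2) ∘ fun k => φ (ψ k) := by
    ext k
    rw [Function.comp_apply, weightedShift_apply, norm_mul, Complex.norm_real, mul_pow,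
      Real.norm_eq_abs, sq_abs]
  have hinj : Function.Injective fun k => φ (ψ k) := φ.injective.comp ψ.injective
  have hs := h.summable.comp_injective hinj
  rw [e]
  refine ⟨hs, ?_⟩
  rw [← h.tsum_eq]
  exact hs.tsum_le_tsum_of_inj _ hinj (fun _ _ => sq_nonneg _) (fun _ => le_rfl) h.summable

/-! ### The six-point test. -/

namespace ShiftWeights

/-- The condition at `k` of the six-point test: positivity of the `2 × 2` matrix of the
self-commutators at the six indices around `k`. -/
def SixPoint (W : ShiftWeights) (k : ℕ × ℕ) : Prop :=
  0 ≤ W.α (k + (1, 0)) ^ 2 - W.α k ^ 2 ∧ 0 ≤ W.β (k + (0, 1)) ^ 2 - W.β k ^ 2 ∧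
    (W.α (k + (0, 1)) * W.β (k + (1, 0)) - W.α k * W.β k) ^ 2 ≤
      (W.α (k + (1, 0)) ^ 2 - W.α k ^ 2) * (W.β (k + (0, 1)) ^ 2 - W.β k ^ 2)

/-- Since `|Q| ≤ √P √R`, the form is at least `(√P ‖u‖ - √R ‖v‖)²`. -/
theorem add_mul_norm_sq_le {P Q R : ℝ} (hP : 0 ≤ P) (hR : 0 ≤ R) (h : Q ^ 2 ≤ P * R) (u v : ℂ) :
    0 ≤ P * ‖u‖ ^ 2 + R * ‖v‖ ^ 2 + 2 * Q * (starRingEnd ℂ v * u).re := by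
  have h1 : |(starRingEnd ℂ v * u).re| ≤ ‖u‖ * ‖v‖ := by
    refine (Complex.abs_re_le_norm _).trans_eq ?_
    rw [norm_mul, Complex.norm_conj, mul_comm]
  have h2 : |Q| ≤ √P * √R := by
    rw [← Real.sqrt_mul hP]
    exact Real.abs_le_sqrt h
  have h3 : |Q * (starRingEnd ℂ v * u).re| ≤ (√P * √R) * (‖u‖ * ‖v‖) := by
    rw [abs_mul]
    exact mul_le_mul h2 h1 (abs_nonneg _) (by positivity)
  have h4 := neg_le_of_abs_le h3
  nlinarith [sq_nonneg (√P * ‖u‖ - √R * ‖v‖), Real.sq_sqrt hP, Real.sq_sqrt hR]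

theorem norm_ofReal_mul_add_sq (b c : ℝ) (u v : ℂ) :
    ‖(b : ℂ) * u + c * v‖ ^ 2 =
      b ^ 2 * ‖u‖ ^ 2 + c ^ 2 * ‖v‖ ^ 2 + 2 * (b * c) * (starRingEnd ℂ v * u).re := by
  rw [← Complex.normSq_eq_norm_sq, ← Complex.normSq_eq_norm_sq, ← Complex.normSq_eq_norm_sq]
  simp only [Complex.normSq_apply, Complex.add_re, Complex.add_im, Complex.mul_re, Complex.mul_im,
    Complex.ofReal_re, Complex.ofReal_im, Complex.conj_re, Complex.conj_im]
  ring

theorem sixPoint_of_isJointlyHyponormal (W : ShiftWeights) (hc : Commute W.T₁ W.T₂)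
    (h : IsJointlyHyponormal W.pair) (k : ℕ × ℕ) : W.SixPoint k := by
  rw [pair, isJointlyHyponormal_iff _ _ hc] at h
  have hn : ∀ (z : ℝ) (l : ℕ × ℕ), ‖(z : ℂ) • lp.single (E := fun _ : ℕ × ℕ => ℂ) 2 l (1 : ℂ)‖ ^ 2 =
      z ^ 2 := by
    intro z l
    rw [norm_smul, lp.norm_single (by norm_num), norm_one, mul_one, Complex.norm_real,
      Real.norm_eq_abs, sq_abs]
  -- Test on `f = u e_{k+(1,0)}`, `g = v e_{k+(0,1)}`: both adjoints land on `e_k`, and both cross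
  -- images land on `e_{k+(1,1)}`.
  have key : ∀ u v : ℝ, (W.α k * u + W.β k * v) ^ 2 ≤ (W.α (k + (1, 0)) * u) ^ 2 +
      (W.β (k + (0, 1)) * v) ^ 2 + 2 * (W.α (k + (0, 1)) * W.β (k + (1, 0)) * (u * v)) := by
    intro u v
    have hu := h ((u : ℂ) • lp.single 2 (k + (1, 0)) (1 : ℂ))
      ((v : ℂ) • lp.single 2 (k + (0, 1)) (1 : ℂ))
    have e₁ := adjoint_weightedShift_single (addRightEmbedding ((1, 0) : ℕ × ℕ)) W.α W.α_bdd k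
    have e₂ := adjoint_weightedShift_single (addRightEmbedding ((0, 1) : ℕ × ℕ)) W.β W.β_bdd k
    rw [addRightEmbedding_apply] at e₁ e₂
    simp only [map_smul, T₁, T₂, weightedShift_single, addRightEmbedding_apply] at hu
    rw [e₁, e₂] at hu
    simp only [smul_smul, ← add_smul, ← Complex.ofReal_mul, ← Complex.ofReal_add] at hu
    rw [hn, hn, hn, inner_smul_left, inner_smul_right, lp.inner_single_left, lp.single_apply,
      add_right_comm k (0, 1) (1, 0), Pi.single_eq_same, Complex.conj_ofReal] at hu
    simp only [RCLike.inner_apply, map_one, mul_one, ← Complex.ofReal_mul,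
      Complex.ofReal_re] at hu
    linarith
  have hP := key 1 0
  have hR := key 0 1
  refine ⟨by linarith, by linarith, ?_⟩
  have hd : ∀ t : ℝ, 0 ≤ (W.α (k + (1, 0)) ^ 2 - W.α k ^ 2) * (t * t) +
      (2 * (W.α (k + (0, 1)) * W.β (k + (1, 0)) - W.α k * W.β k)) * t +
      (W.β (k + (0, 1)) ^ 2 - W.β k ^ 2) := by
    intro t
    have := key t 1
    linarith
  have := discrim_le_zero hd
  rw [discrim] at this
  linarith

/-- Coordinate `k` of `T₁*f + T₂*g` involves only `f (k + (1,0))` and `g (k + (0,1))`, so the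
inequality decouples over `k`. Coordinates of `f` and `g` not reached this way only enlarge the
right side, and the cross term lives on indices `k + (1,1)`. -/
theorem isJointlyHyponormal_of_sixPoint (W : ShiftWeights) (hc : Commute W.T₁ W.T₂)
    (h : ∀ k, W.SixPoint k) : IsJointlyHyponormal W.pair := by
  rw [pair, isJointlyHyponormal_iff _ _ hc]
  intro f g
  have s₁ := summable_and_tsum_norm_weightedShift_sq_le (addRightEmbedding ((1, 0) : ℕ × ℕ))
    (addRightEmbedding ((1, 0) : ℕ × ℕ)) W.α W.α_bdd f
  have s₂ := summable_and_tsum_norm_weightedShift_sq_le (addRightEmbedding ((0, 1) : ℕ × ℕ))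
    (addRightEmbedding ((0, 1) : ℕ × ℕ)) W.β W.β_bdd g
  simp only [addRightEmbedding_apply] at s₁ s₂
  have s₃ : HasSum (fun k => W.α (k + (0, 1)) * W.β (k + (1, 0)) *
      (starRingEnd ℂ (g (k + (0, 1))) * f (k + (1, 0))).re) (inner ℂ (W.T₁ g) (W.T₂ f)).re := by
    have hs := lp.hasSum_inner (𝕜 := ℂ) (W.T₁ g) (W.T₂ f)
    have hinj : Function.Injective fun k : ℕ × ℕ => k + (1, 1) := add_left_injective _
    rw [← hinj.hasSum_iff] at hs
    · refine (Complex.hasSum_re hs).congr_fun ?_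
      intro k
      have e₁ : W.T₁ g (k + (1, 1)) = (W.α (k + (0, 1)) : ℂ) * g (k + (0, 1)) := by
        rw [show k + (1, 1) = addRightEmbedding ((1, 0) : ℕ × ℕ) (k + (0, 1)) by
          rw [addRightEmbedding_apply, add_assoc]; rfl]
        exact weightedShift_apply _ W.α W.α_bdd g _
      have e₂ : W.T₂ f (k + (1, 1)) = (W.β (k + (1, 0)) : ℂ) * f (k + (1, 0)) := by
        rw [show k + (1, 1) = addRightEmbedding ((0, 1) : ℕ × ℕ) (k + (1, 0)) by
          rw [addRightEmbedding_apply, add_assoc]; rfl]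
        exact weightedShift_apply _ W.β W.β_bdd f _
      rw [Function.comp_apply, e₁, e₂, RCLike.inner_apply, map_mul, Complex.conj_ofReal]
      simp only [Complex.mul_re, Complex.mul_im, Complex.ofReal_re, Complex.ofReal_im,
        Complex.conj_re, Complex.conj_im]
      ring
    · rintro ⟨i, j⟩ hl
      have h0 : i = 0 ∨ j = 0 := by
        by_contra hij
        push Not at hij
        exact hl ⟨(i - 1, j - 1), Prod.ext (Nat.succ_pred_eq_of_ne_zero hij.1)
          (Nat.succ_pred_eq_of_ne_zero hij.2)⟩
      rcases h0 with rfl | rfl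
      · have : W.T₁ g (0, j) = 0 := weightedShift_apply_of_notMem _ _ _ _ _ (by
          rintro ⟨l, hl⟩; exact Nat.succ_ne_zero _ (congrArg Prod.fst hl))
        rw [this, inner_zero_left]
      · have : W.T₂ f (i, 0) = 0 := weightedShift_apply_of_notMem _ _ _ _ _ (by
          rintro ⟨l, hl⟩; exact Nat.succ_ne_zero _ (congrArg Prod.snd hl))
        rw [this, inner_zero_right]
  have s₀ := hasSum_norm_sq (ContinuousLinearMap.adjoint W.T₁ f + ContinuousLinearMap.adjoint W.T₂ g)
  have hle : ‖ContinuousLinearMap.adjoint W.T₁ f + ContinuousLinearMap.adjoint W.T₂ g‖ ^ 2 ≤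
      ∑' k, W.α (k + (1, 0)) ^ 2 * ‖f (k + (1, 0))‖ ^ 2 +
      ∑' k, W.β (k + (0, 1)) ^ 2 * ‖g (k + (0, 1))‖ ^ 2 +
        2 * (inner ℂ (W.T₁ g) (W.T₂ f)).re := by
    refine hasSum_le (fun k => ?_) s₀ ((s₁.1.hasSum.add s₂.1.hasSum).add (s₃.mul_left 2))
    obtain ⟨hP, hR, hQ⟩ := h k
    have e : (ContinuousLinearMap.adjoint W.T₁ f + ContinuousLinearMap.adjoint W.T₂ g) k =
        (W.α k : ℂ) * f (k + (1, 0)) + (W.β k : ℂ) * g (k + (0, 1)) := by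
      rw [lp.coeFn_add, Pi.add_apply, T₁, T₂, adjoint_weightedShift_apply,
        adjoint_weightedShift_apply]
      rfl
    rw [e, norm_ofReal_mul_add_sq]
    have := add_mul_norm_sq_le hP hR hQ (f (k + (1, 0))) (g (k + (0, 1)))
    linarith
  exact hle.trans (add_le_add (add_le_add s₁.2 s₂.2) le_rfl)

/-- The six-point test for joint hyponormality of 2-variable weighted shifts. -/
theorem isJointlyHyponormal_pair_iff (W : ShiftWeights) (hc : Commute W.T₁ W.T₂) :
    IsJointlyHyponormal W.pair ↔ ∀ k, W.SixPoint k :=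
  ⟨W.sixPoint_of_isJointlyHyponormal hc, W.isJointlyHyponormal_of_sixPoint hc⟩

end ShiftWeights

/-! ## The two thresholds -/

/-- The six-point test along an axis, for a shift with weights `w` and moments `γ`, from
log-convexity of `γ - c²`. -/
theorem axis_condition {w : ℕ → ℝ} (hw : ∀ n, 0 < w n) {c : ℝ} (k : ℕ)
    (hck : c ^ 2 ≤ shiftMoment w k)
    (h0 : shiftMoment w (k + 1) ^ 2 ≤ shiftMoment w k * shiftMoment w (k + 2))
    (hc : (shiftMoment w (k + 1) - c ^ 2) ^ 2 ≤
      (shiftMoment w k - c ^ 2) * (shiftMoment w (k + 2) - c ^ 2)) :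
    0 ≤ w (k + 1) ^ 2 - w k ^ 2 ∧ 0 ≤ 1 ^ 2 - (c / √(shiftMoment w k)) ^ 2 ∧
      (c / √(shiftMoment w (k + 1)) - w k * (c / √(shiftMoment w k))) ^ 2 ≤
        (w (k + 1) ^ 2 - w k ^ 2) * (1 ^ 2 - (c / √(shiftMoment w k)) ^ 2) := by
  have hg := shiftMoment_pos hw k
  rw [shiftMoment_succ w (k + 1), shiftMoment_succ w k] at h0 hc
  rw [shiftMoment_succ w k, Real.sqrt_mul hg.le, Real.sqrt_sq (hw k).le]
  set g := shiftMoment w k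
  have hp := hw k
  have hr := hw (k + 1)
  set p := w k
  set r := w (k + 1)
  have hs : 0 < √g := Real.sqrt_pos.2 hg
  have hsg : √g ^ 2 = g := Real.sq_sqrt hg.le
  have hpr : p ^ 2 ≤ r ^ 2 := by
    have h1 : 0 < g ^ 2 * p ^ 2 := by positivity
    refine le_of_mul_le_mul_left ?_ h1
    linarith
  refine ⟨sub_nonneg.2 hpr, ?_, ?_⟩
  · rw [div_pow, hsg, one_pow, sub_nonneg, div_le_one hg]
    exact hck
  -- Multiplied by `g`, this is the log-convexity hypothesis `hc` rearranged; divided by `g p²`, it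
  -- is the determinant condition.
  · have key : c ^ 2 * (1 - p ^ 2) ^ 2 ≤ p ^ 2 * (r ^ 2 - p ^ 2) * (g - c ^ 2) := by
      refine le_of_mul_le_mul_left ?_ hg
      linarith
    have e1 : (c / (√g * p) - p * (c / √g)) ^ 2 = c ^ 2 * (1 - p ^ 2) ^ 2 / (√g ^ 2 * p ^ 2) := by
      field_simp
    have e2 : (r ^ 2 - p ^ 2) * (1 ^ 2 - (c / √g) ^ 2) =
        p ^ 2 * (r ^ 2 - p ^ 2) * (g - c ^ 2) / (g * p ^ 2) := by
      rw [div_pow, hsg]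
      field_simp
    rw [e1, e2, hsg]
    gcongr

namespace DiagramData

variable {x y : ℕ → ℝ} {a : ℝ} {W : ShiftWeights} {ξ η₁ : Measure ℝ}

theorem shiftMoment_x_sq_le (h : DiagramData x y a W ξ η₁) {A : ℝ} (hA : A ≤ ξ.real {1})
    (k : ℕ) : (shiftMoment x (k + 1) - A) ^ 2 ≤
      (shiftMoment x k - A) * (shiftMoment x (k + 2) - A) := by
  have := h.prob_ξ
  simpa only [h.moment_ξ] using moment_sub_sq_le h.supp_ξ hA k

theorem shiftMoment_y_sq_le (h : DiagramData x y a W ξ η₁) {A : ℝ} (hA : A ≤ η₁.real {1})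
    (k : ℕ) : (shiftMoment (fun n => y (n + 1)) (k + 1) - A) ^ 2 ≤
      (shiftMoment (fun n => y (n + 1)) k - A) *
        (shiftMoment (fun n => y (n + 1)) (k + 2) - A) := by
  have := h.prob_η₁
  simpa only [h.moment_η₁] using moment_sub_sq_le h.supp_η₁ hA k

theorem sixPoint_of_ne_zero (h : DiagramData x y a W ξ η₁) (k : ℕ × ℕ) (hk : k ≠ 0) :
    W.SixPoint k := by
  obtain ⟨i, j⟩ := k
  have := h.prob_ξ
  have := h.prob_η₁
  cases i with
  | succ i =>
    cases j with
    | succ j => simp [ShiftWeights.SixPoint, h.alpha, h.beta, diagramAlpha, diagramBeta]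
    | zero =>
      have h1 := axis_condition h.x_pos (c := a * y 0) (i + 1)
        (by rw [← h.moment_ξ]
            exact h.atom_ξ.trans (measureReal_one_le_integral_pow h.supp_ξ _))
        (by simpa using h.shiftMoment_x_sq_le measureReal_nonneg (i + 1))
        (h.shiftMoment_x_sq_le h.atom_ξ (i + 1))
      obtain ⟨h2, h3, h4⟩ := h1
      simp only [ShiftWeights.SixPoint, h.alpha, h.beta, Prod.mk_add_mk, add_zero, zero_add,
        diagramAlpha, diagramBeta, one_mul]
      exact ⟨h2, h3, h4⟩
  | zero =>
    cases j with
    | zero => exact absurd rfl hk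
    | succ j =>
      have h1 := axis_condition (fun n => h.y_pos (n + 1)) (c := a) j
        (by rw [← h.moment_η₁]
            exact h.atom_η₁.trans (measureReal_one_le_integral_pow h.supp_η₁ _))
        (by simpa using h.shiftMoment_y_sq_le measureReal_nonneg j)
        (h.shiftMoment_y_sq_le h.atom_η₁ j)
      obtain ⟨h2, h3, h4⟩ := h1
      simp only [ShiftWeights.SixPoint, h.alpha, h.beta, Prod.mk_add_mk, add_zero, zero_add,
        diagramAlpha, diagramBeta, mul_one]
      refine ⟨h3, h2, ?_⟩
      rw [mul_comm (a / _) (y _), mul_comm (1 ^ 2 - _)]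
      exact h4

theorem x_zero_sq_le (h : DiagramData x y a W ξ η₁) : x 0 ^ 2 ≤ x 1 ^ 2 := by
  have := h.prob_ξ
  have h0 := h.shiftMoment_x_sq_le (A := 0) measureReal_nonneg 0
  simp only [shiftMoment_succ, shiftMoment_zero] at h0
  have hx := pow_pos (h.x_pos 0) 2
  nlinarith

/-- The off-diagonal entry at the origin is `y₀ (a² - x₀²) / x₀`; clearing `x₀²` gives the second
condition. -/
theorem sixPoint_zero_iff (h : DiagramData x y a W ξ η₁) :
    W.SixPoint 0 ↔ y 0 ^ 2 ≤ y 1 ^ 2 ∧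
      y 0 ^ 2 * (x 0 ^ 2 * (x 1 ^ 2 - x 0 ^ 2) + (a ^ 2 - x 0 ^ 2) ^ 2) ≤
        x 0 ^ 2 * y 1 ^ 2 * (x 1 ^ 2 - x 0 ^ 2) := by
  have hx := h.x_pos 0
  have hx2 := pow_pos hx 2
  have hb : shiftMoment x 1 = x 0 ^ 2 := by rw [shiftMoment_succ, shiftMoment_zero, one_mul]
  have ha : shiftMoment (fun n => y (n + 1)) 0 = 1 := rfl
  have e0 : (0 : ℕ × ℕ) = (0, 0) := rfl
  simp only [ShiftWeights.SixPoint, h.alpha, h.beta, e0, Prod.mk_add_mk, add_zero, zero_add,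
    diagramAlpha, diagramBeta, hb, ha, Real.sqrt_sq hx.le, Real.sqrt_one, div_one, sub_nonneg,
    h.x_zero_sq_le, true_and]
  refine and_congr_right fun _ => ?_
  have e : (a * (a * y 0 / x 0) - x 0 * y 0) ^ 2 = y 0 ^ 2 * (a ^ 2 - x 0 ^ 2) ^ 2 / x 0 ^ 2 := by
    field_simp
  rw [e, div_le_iff₀ hx2]
  constructor <;> intro h' <;> linarith

theorem isJointlyHyponormal_iff (h : DiagramData x y a W ξ η₁) (hc : Commute W.T₁ W.T₂) :
    IsJointlyHyponormal W.pair ↔ y 0 ^ 2 ≤ y 1 ^ 2 ∧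
      y 0 ^ 2 * (x 0 ^ 2 * (x 1 ^ 2 - x 0 ^ 2) + (a ^ 2 - x 0 ^ 2) ^ 2) ≤
        x 0 ^ 2 * y 1 ^ 2 * (x 1 ^ 2 - x 0 ^ 2) := by
  rw [W.isJointlyHyponormal_pair_iff hc, ← h.sixPoint_zero_iff]
  refine ⟨fun h' => h' 0, fun h0 k => ?_⟩
  by_cases hk : k = 0
  · rwa [hk]
  · exact h.sixPoint_of_ne_zero k hk

/-- Outside the degenerate case `x₀ = x₁ = a`, joint hyponormality amounts to `y₀ ≤ h`. -/
theorem isJointlyHyponormal_iff_le_hypoThreshold (h : DiagramData x y a W ξ η₁)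
    (hc : Commute W.T₁ W.T₂)
    (hD : 0 < x 0 ^ 2 * (x 1 ^ 2 - x 0 ^ 2) + (a ^ 2 - x 0 ^ 2) ^ 2) :
    IsJointlyHyponormal W.pair ↔ y 0 ≤ hypoThreshold (x 0) (x 1) (y 1) a := by
  rw [h.isJointlyHyponormal_iff hc, hypoThreshold, Real.le_sqrt' (h.y_pos 0), le_div_iff₀ hD]
  refine ⟨fun h' => h'.2, fun h' => ⟨?_, h'⟩⟩
  have hx := pow_pos (h.x_pos 0) 2
  have hy := pow_pos (h.y_pos 0) 2
  have hx1 := h.x_zero_sq_le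
  -- The condition `y₀ ≤ y₁` is redundant: if `x₀ = x₁` the inequality contradicts `hD`; otherwise
  -- drop the square term and cancel `x₀² (x₁² - x₀²)`.
  rcases hx1.eq_or_lt with heq | hlt
  · rw [heq, sub_self, mul_zero, mul_zero] at h'
    rw [heq, sub_self, mul_zero] at hD
    exact absurd h' (not_le.2 (mul_pos hy hD))
  · refine le_of_mul_le_mul_right ?_ (mul_pos hx (sub_pos.2 hlt))
    have := mul_nonneg hy.le (sq_nonneg (a ^ 2 - x 0 ^ 2))
    linarith

theorem integral_abs_one_div (h : DiagramData x y a W ξ η₁) :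
    ∫ t, |1 / t| ∂η₁ = ∫ t, 1 / t ∂η₁ :=
  integral_congr_ae (h.supp_η₁.mono fun _ ht => abs_of_nonneg (one_div_nonneg.2 ht.1))

theorem sq_le_integral_one_div (h : DiagramData x y a W ξ η₁)
    (hint : Integrable (fun t => 1 / t) η₁) : a ^ 2 ≤ ∫ t, 1 / t ∂η₁ := by
  have := h.prob_η₁
  refine h.atom_η₁.trans ?_
  rw [← integral_ite_eq_measureReal]
  refine integral_mono_ae (integrable_ite_eq 1) hint (h.supp_η₁.mono fun t ht => ?_)
  simp only
  split_ifs with h1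
  · simp [h1]
  · exact one_div_nonneg.2 ht.1

theorem subThreshold_lt_iff (h : DiagramData x y a W ξ η₁)
    (hint : Integrable (fun t => 1 / t) η₁) :
    subThreshold (ξ.real {0}) (ξ.real {1}) (∫ t, |1 / t| ∂η₁) a < y 0 ↔
      ξ.real {0} < y 0 ^ 2 * (∫ t, 1 / t ∂η₁ - a ^ 2) := by
  rw [h.integral_abs_one_div]
  have hr := h.sq_le_integral_one_div hint
  set r := ∫ t, 1 / t ∂η₁
  -- The atom bound for `ξ`, so the first term of the minimum is never below `y₀`.
  have hq : y 0 ≤ √(ξ.real {1} / a ^ 2) := by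
    rw [Real.le_sqrt' (h.y_pos 0), le_div_iff₀ (pow_pos h.a_pos 2)]
    have := h.atom_ξ
    linarith
  rw [subThreshold]
  split_ifs with h1
  · rw [h1, sub_self, mul_zero]
    exact iff_of_false (not_lt.2 hq) (not_lt.2 measureReal_nonneg)
  · have hlt : 0 < r - a ^ 2 := sub_pos.2 (lt_of_le_of_ne hr (Ne.symm h1))
    rw [min_lt_iff, or_iff_right (not_lt.2 hq), Real.sqrt_lt' (h.y_pos 0), div_lt_iff₀ hlt]

/-- In the degenerate case `x₀ = x₁ = a` of the threshold `h`, both `ξ` and `η₁` are the unit mass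
at `1`. -/
theorem integral_one_div_eq_sq (h : DiagramData x y a W ξ η₁)
    (hD : x 0 ^ 2 * (x 1 ^ 2 - x 0 ^ 2) + (a ^ 2 - x 0 ^ 2) ^ 2 ≤ 0) :
    ∫ t, 1 / t ∂η₁ = a ^ 2 := by
  have := h.prob_ξ
  have := h.prob_η₁
  have hx := pow_pos (h.x_pos 0) 2
  have h1 : 0 ≤ x 0 ^ 2 * (x 1 ^ 2 - x 0 ^ 2) := mul_nonneg hx.le (sub_nonneg.2 h.x_zero_sq_le)
  have h2 := sq_nonneg (a ^ 2 - x 0 ^ 2)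
  have ha : a ^ 2 = x 0 ^ 2 := sub_eq_zero.1 (pow_eq_zero_iff two_ne_zero |>.1 (by linarith))
  have hx1 : x 1 ^ 2 = x 0 ^ 2 :=
    sub_eq_zero.1 ((mul_eq_zero.1 (le_antisymm (by linarith) h1)).resolve_left hx.ne')
  have hq : 0 < ξ.real {1} := (pow_pos (mul_pos h.a_pos (h.y_pos 0)) 2).trans_le h.atom_ξ
  -- Removing the whole atom at `1` from the moments `1, a², a⁴` leaves `ξ{1} (1 - a²)² ≤ 0`. Hence
  -- `a = 1`, and the atom bound forces all of `η₁` onto `1`.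
  have h3 := h.shiftMoment_x_sq_le le_rfl 0
  simp only [shiftMoment_succ, shiftMoment_zero, hx1, ← ha, one_mul] at h3
  have h4 : ξ.real {1} * (1 - a ^ 2) ^ 2 ≤ 0 := by linarith
  have h5 : a ^ 2 = 1 := by
    have h6 : (1 - a ^ 2) ^ 2 = 0 := le_antisymm (nonpos_of_mul_nonpos_right h4 hq) (sq_nonneg _)
    linarith [pow_eq_zero_iff two_ne_zero |>.1 h6]
  have h7 : η₁.real {1} = 1 := le_antisymm measureReal_le_one (h5 ▸ h.atom_η₁)
  have h8 : ∀ᵐ t ∂η₁, t = 1 := by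
    have : η₁ {1} = 1 := by
      rw [← ofReal_measureReal, h7, ENNReal.ofReal_one]
    exact (prob_compl_eq_zero_iff (measurableSet_singleton (1 : ℝ))).2 this
  have h9 : ∫ t, 1 / t ∂η₁ = ∫ _, (1 : ℝ) ∂η₁ :=
    integral_congr_ae (h8.mono fun t ht => by simp [ht])
  rw [h9, h5]
  simp

end DiagramData

theorem corollary5p5 (x y : ℕ → ℝ) (a : ℝ) (W : ShiftWeights)
    (hα : W.α = diagramAlpha x y a) (hβ : W.β = diagramBeta x y a) (hW : W.IsSFC)
    (ξ η₁ : MeasureTheory.Measure ℝ) (hξ : IsBergerMeasure x ξ)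
    (hη₁ : IsBergerMeasure (fun n => y (n + 1)) η₁) :
    (IsJointlyHyponormal W.pair ∧ ¬ IsJointlySubnormal W.pair) ↔
      subThreshold (ξ.real {0}) (ξ.real {1}) (∫ t, |1 / t| ∂η₁) a < y 0 ∧
        y 0 ≤ hypoThreshold (x 0) (x 1) (y 1) a := by
  have h := DiagramData.of_isSFC hα hβ hW hξ hη₁
  rw [h.isJointlySubnormal_iff hW.subnormal₂, not_le,
    h.subThreshold_lt_iff (h.integrable_one_div hW.subnormal₂).2.1, and_comm]
  -- Non-subnormality `hs` excludes the degenerate denominator: there `∫ 1/t dη₁ = a²`, and `hs`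
  -- would say `ξ{0} < 0`.
  refine and_congr_right fun hs => h.isJointlyHyponormal_iff_le_hypoThreshold hW.comm ?_
  by_contra hD
  rw [h.integral_one_div_eq_sq (not_lt.1 hD), sub_self, mul_zero] at hs
  exact absurd hs (not_lt.2 measureReal_nonneg)
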